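/- Let $n\ge 3$. For a unit vector $u\in\mathbb R^n$ and $\gamma\ge 0$ let $\lambda_{\gamma,n,0}$ be the lowest eigenvalue of the operator $-\Delta_{\mathbb S^{n-1}}+\gamma\,(u,\omega)$ in $L^2(\mathbb S^{n-1})$, given by the min-max principle as the infimum of $$\int_{\mathbb S^{n-1}}\big(|\nabla_{\mathbb S^{n-1}}F(\omega)|^2+\gamma\,(u,\omega)|F(\omega)|^2\big)\,d\omega$$ over all $F\in C^\infty(\mathbb S^{n-1})$ with $\int_{\mathbb S^{n-1}}|F|^2\,d\omega=1$. Let $D^1(\mathbb R^n)$ be the completion of $C_0^\infty(\mathbb R^n)$ with respect to the norm $\|\nabla g\|_{L^2(\mathbb R^n)}$, realized as a space of functions in $L^{2n/(n-2)}(\mathbb R^n)$ by the Sobolev inequality. All functions are complex valued. There is a constant $\gamma_{c,n}>0$, depending only on $n$, with the following properties. (i) For every unit vector $u$ and every $\gamma\ge 0$: $\lambda_{\gamma,n,0}=-(n-2)^2/4$ if and only if $\gamma=\gamma_{c,n}$, and $\lambda_{\gamma,n,0}\ge-(n-2)^2/4$ if and only if $\gamma\le\gamma_{c,n}$. (ii)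 $\gamma_{c,n}$ is the largest $\gamma\ge 0$ such that, for all $u\in\mathbb R^n$ with $|u|=1$, all $f\in D^1(\mathbb R^n)$ and both signs, $$\int_{\mathbb R^n}|\nabla f(x)|^2\,d^nx\;\ge\;\pm\gamma\int_{\mathbb R^n}(u,x)|x|^{-3}|f(x)|^2\,d^nx,\qquad(*)$$ where the integral on the right converges absolutely. (iii) For every $\gamma\in[0,\gamma_{c,n}]$, including the critical value $\gamma=\gamma_{c,n}$, and every $u\in\mathbb R^n$ with $|u|=1$, the inequality $(*)$ is strict on $H^1(\mathbb R^n)$: for every $f\in H^1(\mathbb R^n)$ and either sign, the integral on the right converges absolutely, $(*)$ holds, and equality holds in $(*)$ if and only if $f=0$ (almost everywhere). -/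

import Mathlib

open MeasureTheory Filter Topology
open scoped ContDiff ENNReal

noncomputable section

namespace Dipole

/-- Euclidean space `ℝⁿ`. -/
abbrev Space (n : ℕ) : Type := EuclideanSpace ℝ (Fin n)

/-- The classical partial derivative `∂ᵢ g (x)`. -/
def partialDeriv {n : ℕ} {V : Type*} [NormedAddCommGroup V] [NormedSpace ℝ V]
    (g : Space n → V) (i : Fin n) (x : Space n) : V :=
  fderiv ℝ g x (EuclideanSpace.single i 1)

/-- The classical gradient of a complex valued function, a vector of `ℂⁿ` with its Euclidean
norm `(∑ᵢ |∂ᵢ g (x)|²) ^ (1/2)`. -/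
def gradVec {n : ℕ} (g : Space n → ℂ) (x : Space n) : EuclideanSpace ℂ (Fin n) :=
  WithLp.toLp 2 fun i => partialDeriv g i x

/-- `f ∈ H¹(ℝⁿ)` with weak (distributional) gradient `G`: both are square integrable, and
`∫ (∂ᵢ φ) f = - ∫ φ Gᵢ` for all real test functions `φ ∈ C₀^∞(ℝⁿ)`. -/
structure MemH1 {n : ℕ} (f : Space n → ℂ) (G : Space n → EuclideanSpace ℂ (Fin n)) : Prop where
  memLp : MemLp f 2 volume
  memLp_grad : MemLp G 2 volume
  weak_grad : ∀ φ : Space n → ℝ, ContDiff ℝ ∞ φ → HasCompactSupport φ → ∀ i : Fin n,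
    ∫ x, partialDeriv φ i x • f x = - ∫ x, φ x • G x i

/-- `f ∈ D¹(ℝⁿ)`, `n ≥ 3`, with gradient `G`: the completion of `C₀^∞(ℝⁿ)` in the norm
`‖∇ g‖_{L²}`, realized as a space of functions in `L^{2n/(n-2)}(ℝⁿ)` by the Sobolev inequality. -/
structure MemD1 {n : ℕ} (f : Space n → ℂ) (G : Space n → EuclideanSpace ℂ (Fin n)) : Prop where
  memLp : MemLp f (ENNReal.ofReal (2 * n / (n - 2))) volume
  memLp_grad : MemLp G 2 volume
  approx : ∃ g : ℕ → Space n → ℂ,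
    (∀ j, ContDiff ℝ ∞ (g j) ∧ HasCompactSupport (g j)) ∧
    Tendsto (fun j => eLpNorm (gradVec (g j) - G) 2 volume) atTop (𝓝 0) ∧
    Tendsto (fun j => eLpNorm (g j - f) (ENNReal.ofReal (2 * n / (n - 2))) volume) atTop (𝓝 0)

/-- The integrand `(u, x) |x|⁻³ |f(x)|²`. -/
def dipoleDensity {n : ℕ} (u : Space n) (f : Space n → ℂ) (x : Space n) : ℝ :=
  inner ℝ u x / ‖x‖ ^ 3 * ‖f x‖ ^ 2

/-- The dipole inequality on `D¹(ℝⁿ)` with coupling constant `γ`, for all directions `u` and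
both signs:  `∫ |∇ f|² ≥ ± γ ∫ (u, x) |x|⁻³ |f|²`. -/
def DipoleInequality (n : ℕ) (γ : ℝ) : Prop :=
  ∀ u : Space n, ‖u‖ = 1 → ∀ (f : Space n → ℂ) (G : Space n → EuclideanSpace ℂ (Fin n)),
    MemD1 f G → Integrable (dipoleDensity u f) ∧
      γ * ∫ x, dipoleDensity u f x ≤ ∫ x, ‖G x‖ ^ 2 ∧
      -γ * ∫ x, dipoleDensity u f x ≤ ∫ x, ‖G x‖ ^ 2

/-- Smooth functions on the unit sphere `𝕊ⁿ⁻¹`, represented by their extensions to `ℝⁿ ∖ {0}`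
that are homogeneous of degree zero, `F(x) = F(x/|x|)`. -/
structure IsSphereSmooth {n : ℕ} (F : Space n → ℂ) : Prop where
  contDiffOn : ContDiffOn ℝ ∞ F {0}ᶜ
  homogeneous : ∀ r : ℝ, 0 < r → ∀ x, F (r • x) = F x

/-- The quadratic form `(F, Λ F)_{L²(𝕊ⁿ⁻¹)} = ∫ (|∇_𝕊 F|² + γ (u, ω) |F|²) dω` of the operator
`Λ = -Δ_𝕊 + γ cos θ`, where `cos θ = (u, ω)` and `dω` is the surface measure. The gradient at a
point of the sphere of the extension that is homogeneous of degree zero is the tangential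
gradient `∇_𝕊 F`. -/
def sphereForm {n : ℕ} (u : Space n) (γ : ℝ) (F : Space n → ℂ) : ℝ :=
  ∫ y : Metric.sphere (0 : Space n) 1,
    (‖gradVec F y‖ ^ 2 + γ * inner ℝ u (y : Space n) * ‖F y‖ ^ 2)
    ∂(volume : Measure (Space n)).toSphere

/-- The lowest eigenvalue of `Λ = -Δ_𝕊 + γ (u, ω)` in `L²(𝕊ⁿ⁻¹)`, by the min-max principle:
the infimum of the quadratic form over the normalized functions in the core `C^∞(𝕊ⁿ⁻¹)`. -/
def lowestEigenvalue {n : ℕ} (u : Space n) (γ : ℝ) : ℝ :=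
  sInf {q : ℝ | ∃ F : Space n → ℂ, IsSphereSmooth F ∧
    ∫ y : Metric.sphere (0 : Space n) 1, ‖F y‖ ^ 2 ∂(volume : Measure (Space n)).toSphere = 1 ∧
    q = sphereForm u γ F}

end Dipole

end

noncomputable section

namespace Dipole

/-! In polar coordinates `|∇f|²` is the squared radial derivative plus `r⁻²` times the squared
spherical gradient, and the dipole weight is `r⁻² (u, ω)`. On every sphere the angular terms
together are at least `λ_γ r⁻² |f|²` in the mean, while Hardy's inequality bounds the radial term
below by `(n-2)²/4` times `∫ |f|²/|x|²`. Hence `λ_γ ≥ -(n-2)²/4` suffices for the inequality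
(`dipole_testFunction`). Trial functions `ψ(log r) F(ω)` which nearly saturate Hardy's inequality
show that it is also necessary (`DipoleInequality.le_lowestEigenvalue`).

As an infimum of affine functions of `γ` with slopes in `[-1, 1]`, `λ_γ` is Lipschitz. It vanishes
at `γ = 0`, tends to `-∞`, and satisfies `t λ_γ ≤ λ_{tγ}` for `0 ≤ t ≤ 1`, so it crosses each
negative level exactly once (`exists_critical`). Rotation invariance makes the crossing point
independent of `u`, and replacing `u` by `-u` exchanges the two signs.

For strictness, including the critical coupling, the Hardy remainder `∫ |x·∇f + (n-2)f/2|² / |x|²`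
is kept. If the form vanishes at `f`, the remainder tends to zero along approximating test
functions. By `weighted_norm_le` a weighted `L²` norm is at most `δ ‖f‖²` plus `δ⁻¹` times the
remainder; since `f` is in `L²`, letting `δ → 0` forces `f = 0`.

Hardy's inequality makes the dipole form continuous under `L²` convergence of gradients
(`Approximates`), so everything passes from test functions to the limit. Test functions approximate
`D¹` by definition and `H¹` by mollification and cutoff (`MemH1.exists_approximates`). -/

/-! ### Gradients and their radial and tangential parts. -/

/-- The components of a real linear functional with values in `ℂ`. -/
def gradOf {n : ℕ} : (Space n →L[ℝ] ℂ) →ₗ[ℝ] EuclideanSpace ℂ (Fin n) where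
  toFun L := WithLp.toLp 2 fun i => L (EuclideanSpace.single i 1)
  map_add' L M := by ext i; simp
  map_smul' c L := by ext i; simp

lemma gradVec_eq_gradOf {n : ℕ} (f : Space n → ℂ) (x : Space n) :
    gradVec f x = gradOf (fderiv ℝ f x) := rfl

lemma continuous_gradOf {n : ℕ} : Continuous (gradOf : (Space n →L[ℝ] ℂ) → _) :=
  (gradOf (n := n)).continuous_of_finiteDimensional

lemma norm_gradOf_sq {n : ℕ} (L : Space n →L[ℝ] ℂ) :
    ‖gradOf L‖ ^ 2 = ∑ i, ‖L (EuclideanSpace.single i 1)‖ ^ 2 := by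
  rw [EuclideanSpace.norm_sq_eq]; rfl

lemma apply_eq_sum {n : ℕ} (L : Space n →L[ℝ] ℂ) (y : Space n) :
    L y = ∑ i, y i • L (EuclideanSpace.single i 1) := by
  conv_lhs => rw [← (EuclideanSpace.basisFun (Fin n) ℝ).sum_repr y]
  simp

/-- Pythagoras: the tangential part of the gradient. -/
lemma norm_gradOf_tangential_sq {n : ℕ} (L M : Space n →L[ℝ] ℂ) (y : Space n) (hy : ‖y‖ = 1)
    (hM : ∀ v, M v = L v - inner ℝ y v • L y) :
    ‖gradOf M‖ ^ 2 + ‖L y‖ ^ 2 = ‖gradOf L‖ ^ 2 := by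
  rw [norm_gradOf_sq, norm_gradOf_sq]
  have h1 : ∀ i, ‖M (EuclideanSpace.single i 1)‖ ^ 2 = ‖L (EuclideanSpace.single i 1)‖ ^ 2
      - 2 * inner ℝ (y i • L (EuclideanSpace.single i 1)) (L y) + (y i) ^ 2 * ‖L y‖ ^ 2 := by
    intro i
    rw [hM, norm_sub_sq_real, norm_smul, inner_smul_right, inner_smul_left]
    simp [EuclideanSpace.inner_single_right, mul_pow]
  simp_rw [h1]
  rw [Finset.sum_add_distrib, Finset.sum_sub_distrib, ← Finset.mul_sum, ← sum_inner,
    ← apply_eq_sum, ← Finset.sum_mul]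
  have h2 : ∑ i, (y i) ^ 2 = 1 := by
    have := EuclideanSpace.real_norm_sq_eq y
    rw [hy] at this; linarith
  rw [h2, real_inner_self_eq_norm_sq]; ring

/-- Pythagoras in the direction `x/|x|`, with the tangential part dropped. -/
lemma norm_apply_sq_le {n : ℕ} (L : Space n →L[ℝ] ℂ) (x : Space n) :
    ‖L x‖ ^ 2 ≤ ‖x‖ ^ 2 * ‖gradOf L‖ ^ 2 := by
  rcases eq_or_ne x 0 with rfl | hx
  · simp
  have hx' : 0 < ‖x‖ := norm_pos_iff.2 hx
  have h := norm_gradOf_tangential_sq L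
    (L - (innerSL ℝ (‖x‖⁻¹ • x)).smulRight (L (‖x‖⁻¹ • x))) (‖x‖⁻¹ • x)
    (by rw [norm_smul]; simp [hx'.ne']) (by intro v; simp [real_inner_smul_left])
  rw [map_smul L, norm_smul, norm_inv, norm_norm, mul_pow, inv_pow] at h
  have h2 : (‖x‖ ^ 2)⁻¹ * ‖L x‖ ^ 2 ≤ ‖gradOf L‖ ^ 2 := by
    rw [← h]; exact le_add_of_nonneg_left (sq_nonneg _)
  rwa [inv_mul_le_iff₀ (by positivity)] at h2

/-! ### Polar coordinates -/

section Polar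

variable {n : ℕ}

/-- The surface measure of the unit sphere. -/
abbrev surf (n : ℕ) : Measure (Metric.sphere (0 : Space n) 1) :=
  (volume : Measure (Space n)).toSphere

lemma integral_volumeIoiPow (m : ℕ) (k : ℝ → ℝ) :
    ∫ r : Set.Ioi (0 : ℝ), k r ∂(Measure.volumeIoiPow m) =
      ∫ r in Set.Ioi (0 : ℝ), r ^ m * k r := by
  simp only [Measure.volumeIoiPow, ENNReal.ofReal]
  rw [integral_withDensity_eq_integral_smul,
    integral_subtype_comap measurableSet_Ioi fun a ↦ Real.toNNReal (a ^ m) • k a,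
    setIntegral_congr_fun measurableSet_Ioi fun x hx ↦ ?_]
  · simp only [NNReal.smul_def, Real.coe_toNNReal _ (pow_nonneg (le_of_lt hx) m), smul_eq_mul]
  · exact (measurable_subtype_coe.pow_const _).real_toNNReal

lemma polar_integrable {H : Space n → ℝ} (hH : Integrable H) :
    Integrable (fun p : Metric.sphere (0 : Space n) 1 × Set.Ioi (0 : ℝ) =>
      H ((p.2 : ℝ) • (p.1 : Space n))) ((surf n).prod (Measure.volumeIoiPow (n - 1))) := by
  have h := (volume : Measure (Space n)).measurePreserving_homeomorphUnitSphereProd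
  rw [finrank_euclideanSpace_fin] at h
  rw [← h.integrable_comp_emb (Homeomorph.measurableEmbedding _)]
  have h2 : Integrable (fun x : ({0}ᶜ : Set (Space n)) => H x) (volume.comap Subtype.val) :=
    (integrableOn_iff_comap_subtypeVal (measurableSet_singleton _).compl).1 hH.integrableOn
  refine h2.congr (Eventually.of_forall fun x => ?_)
  have hx : (x : Space n) ≠ 0 := x.2
  simp [smul_smul, hx]

/-- In polar coordinates the singularity `|x|⁻²` meets the Jacobian `r^(n-1)` and leaves `r^(n-3)`,
which is continuous at the origin because `n ≥ 3`. -/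
lemma integrable_of_le_inv_sq (hn : 3 ≤ n) {H : Space n → ℝ}
    (hm : AEStronglyMeasurable H volume) {C R : ℝ}
    (hb : ∀ x, ‖x‖ ≤ R → |H x| ≤ C / ‖x‖ ^ 2) (hs : ∀ x, R < ‖x‖ → H x = 0) :
    Integrable H := by
  have : Nonempty (Fin n) := ⟨⟨0, by omega⟩⟩
  have h1 : Integrable (fun x : Space n => Set.indicator (Set.Iic R) (fun r => |C| / r ^ 2) ‖x‖) := by
    rw [integrable_fun_norm_addHaar volume (f := Set.indicator (Set.Iic R) (fun r => |C| / r ^ 2)),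
      finrank_euclideanSpace_fin]
    have h2 : IntegrableOn (fun r : ℝ => |C| * r ^ (n - 3)) (Set.Ioc 0 R) :=
      (by fun_prop : Continuous (fun r : ℝ => |C| * r ^ (n - 3))).integrableOn_Ioc
    have h3 : IntegrableOn (Set.indicator (Set.Iic R) (fun r : ℝ => |C| * r ^ (n - 3)))
        (Set.Ioi 0) := by
      rw [IntegrableOn, integrable_indicator_iff measurableSet_Iic, IntegrableOn,
        Measure.restrict_restrict measurableSet_Iic, Set.inter_comm, Set.Ioi_inter_Iic]
      exact h2
    refine h3.congr_fun (fun r hr => ?_) measurableSet_Ioi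
    have hr' : (0 : ℝ) < r := hr
    by_cases h : r ∈ Set.Iic R
    · simp only [Set.indicator_of_mem h, smul_eq_mul]
      obtain ⟨m, rfl⟩ := Nat.exists_eq_add_of_le hn
      have e1 : 3 + m - 3 = m := by omega
      have e2 : 3 + m - 1 = m + 2 := by omega
      rw [e1, e2]; field_simp; ring
    · simp [Set.indicator_of_notMem h]
  refine h1.mono' hm (Eventually.of_forall fun x => ?_)
  by_cases h : ‖x‖ ≤ R
  · rw [Set.indicator_of_mem (by exact h), Real.norm_eq_abs]
    exact (hb x h).trans (by gcongr; exact le_abs_self C)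
  · rw [Set.indicator_of_notMem (by simpa using h), hs x (by linarith)]; simp

lemma integrable_div_sq (hn : 3 ≤ n) {H K : Space n → ℝ} (hH : Continuous H)
    (hs : HasCompactSupport H) (hKm : Measurable K) (hK : ∀ x, |K x| ≤ |H x| / ‖x‖ ^ 2) :
    Integrable K := by
  obtain ⟨C, hC⟩ := hH.bounded_above_of_compact_support hs
  obtain ⟨R, hR⟩ := hs.isCompact.isBounded.subset_closedBall (0 : Space n)
  refine integrable_of_le_inv_sq hn hKm.aestronglyMeasurable (C := C) (R := R)
    (fun x _ => (hK x).trans ?_) (fun x hx => ?_)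
  · gcongr; exact hC x
  · have : x ∉ tsupport H := fun h => by
      linarith [mem_closedBall_zero_iff.1 (hR h)]
    have h2 := hK x
    rw [image_eq_zero_of_notMem_tsupport this] at h2
    rwa [abs_zero, zero_div, abs_nonpos_iff] at h2

variable [Nonempty (Fin n)]

lemma polar_integral (H : Space n → ℝ) :
    ∫ x, H x = ∫ p : Metric.sphere (0 : Space n) 1 × Set.Ioi (0 : ℝ),
      H ((p.2 : ℝ) • (p.1 : Space n)) ∂((surf n).prod (Measure.volumeIoiPow (n - 1))) := by
  have h := (volume : Measure (Space n)).measurePreserving_homeomorphUnitSphereProd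
  rw [finrank_euclideanSpace_fin] at h
  rw [← h.integral_comp (Homeomorph.measurableEmbedding _)]
  have h2 : ∫ x, H x = ∫ x : ({0}ᶜ : Set (Space n)), H x ∂(volume.comap Subtype.val) := by
    rw [integral_subtype_comap (measurableSet_singleton _).compl, restrict_compl_singleton]
  rw [h2]
  refine integral_congr_ae (Eventually.of_forall fun x => ?_)
  have hx : (x : Space n) ≠ 0 := x.2
  simp [smul_smul, hx]

/-- Radial integration inside: the form suited to integrating by parts along rays. The companion
`polar_integral_shell` integrates over spheres inside, where the eigenvalue bound applies. -/
lemma polar_integral_ray {H : Space n → ℝ} (hH : Integrable H) :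
    ∫ x, H x = ∫ y, (∫ r in Set.Ioi (0 : ℝ), r ^ (n - 1) * H (r • (y : Space n))) ∂(surf n) := by
  rw [polar_integral, integral_prod _ (polar_integrable hH)]
  simp_rw [← integral_volumeIoiPow]

lemma polar_integral_shell {H : Space n → ℝ} (hH : Integrable H) :
    ∫ x, H x = ∫ r in Set.Ioi (0 : ℝ), r ^ (n - 1) * ∫ y, H (r • (y : Space n)) ∂(surf n) := by
  rw [polar_integral, integral_prod_symm _ (polar_integrable hH)]
  rw [← integral_volumeIoiPow (n - 1) (fun r => ∫ y, H (r • (y : Space n)) ∂(surf n))]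

/-- The divergence theorem for the radial vector field `|x|^(m-n) k(x) x`. -/
lemma integral_radial_divergence {m : ℕ} (hm : 1 ≤ m) {k : Space n → ℝ}
    (hk : ContDiff ℝ 1 k)
    (hs : HasCompactSupport k)
    (hi : Integrable fun x => (fderiv ℝ k x x + m * k x) * (‖x‖ ^ m / ‖x‖ ^ n)) :
    ∫ x, (fderiv ℝ k x x + m * k x) * (‖x‖ ^ m / ‖x‖ ^ n) = 0 := by
  rw [polar_integral_ray hi]
  refine integral_eq_zero_of_ae (Eventually.of_forall fun y => ?_)
  have hy : ‖(y : Space n)‖ = 1 := by simp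
  have hy0 : (y : Space n) ≠ 0 := by intro h; simp [h] at hy
  -- On each ray the integrand times the Jacobian `r^(n-1)` is exactly `K'(r)`, so only boundary
  -- values remain.
  set K : ℝ → ℝ := fun r => r ^ m * k (r • (y : Space n)) with hKdef
  have hKs : HasCompactSupport K := by
    apply HasCompactSupport.mul_left
    exact hs.comp_isClosedEmbedding (isClosedEmbedding_smul_left (𝕜 := ℝ) hy0)
  have hKc : ContDiff ℝ 1 K := by fun_prop
  have hd : ∀ r, deriv K r = m * r ^ (m - 1) * k (r • (y : Space n)) +
      r ^ m * fderiv ℝ k (r • (y : Space n)) y := by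
    intro r
    have h1 : HasDerivAt (fun r : ℝ => r • (y : Space n)) (y : Space n) r := by
      simpa using (hasDerivAt_id r).smul_const (y : Space n)
    exact ((hasDerivAt_pow m r).mul
      (((hk.differentiable one_ne_zero _).hasFDerivAt).comp_hasDerivAt r h1)).deriv
  have h0 : ∫ r in Set.Ioi (0 : ℝ), deriv K r = -K 0 := HasCompactSupport.integral_Ioi_deriv_eq hKc hKs 0
  -- The boundary term at the origin vanishes because `m ≥ 1`.
  rw [show K 0 = 0 by simp [hKdef, Nat.one_le_iff_ne_zero.1 hm], neg_zero] at h0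
  refine Eq.trans ?_ h0
  refine setIntegral_congr_fun measurableSet_Ioi fun r hr0 => ?_
  have hr : (0 : ℝ) < r := hr0
  simp only [hd, norm_smul, hy, Real.norm_eq_abs, abs_of_pos hr, mul_one, map_smul, smul_eq_mul]
  obtain ⟨m, rfl⟩ := Nat.exists_eq_add_of_le' hm
  obtain ⟨n', rfl⟩ := Nat.exists_eq_add_of_le' (Fin.pos_iff_nonempty.2 ‹Nonempty (Fin n)›)
  simp only [Nat.add_sub_cancel]
  field_simp
  ring

end Polar

/-! ### The quadratic form on the sphere -/

section Sphere

variable {n : ℕ} {F : Space n → ℂ}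

lemma ne_zero_of_sphere (y : Metric.sphere (0 : Space n) 1) : (y : Space n) ≠ 0 := by
  intro h
  have : ‖(y : Space n)‖ = 1 := by simp
  simp [h] at this

lemma IsSphereSmooth.continuous_sphere (hF : IsSphereSmooth F) :
    Continuous fun y : Metric.sphere (0 : Space n) 1 => F y :=
  hF.contDiffOn.continuousOn.comp_continuous continuous_subtype_val fun y => ne_zero_of_sphere y

lemma IsSphereSmooth.contDiffAt (hF : IsSphereSmooth F) {x : Space n} (hx : x ≠ 0) :
    ContDiffAt ℝ ∞ F x :=
  hF.contDiffOn.contDiffAt (isOpen_compl_singleton.mem_nhds hx)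

lemma IsSphereSmooth.differentiableAt (hF : IsSphereSmooth F) {x : Space n} (hx : x ≠ 0) :
    DifferentiableAt ℝ F x :=
  (hF.contDiffAt hx).differentiableAt (by simp)

lemma IsSphereSmooth.continuous_gradVec (hF : IsSphereSmooth F) :
    Continuous fun y : Metric.sphere (0 : Space n) 1 => gradVec F y := by
  have h : ContinuousOn (fderiv ℝ F) {0}ᶜ :=
    hF.contDiffOn.continuousOn_fderiv_of_isOpen isOpen_compl_singleton (by simp)
  exact continuous_gradOf.comp
    (h.comp_continuous continuous_subtype_val fun y => ne_zero_of_sphere y)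

lemma integrable_surf {h : Metric.sphere (0 : Space n) 1 → ℝ} (hh : Continuous h) :
    Integrable h (surf n) :=
  hh.integrable_of_hasCompactSupport (HasCompactSupport.of_compactSpace h)

lemma IsSphereSmooth.continuous_norm_sq (hF : IsSphereSmooth F) :
    Continuous fun y : Metric.sphere (0 : Space n) 1 => ‖F y‖ ^ 2 :=
  hF.continuous_sphere.norm.pow 2

lemma IsSphereSmooth.continuous_dipole (hF : IsSphereSmooth F) (u : Space n) :
    Continuous fun y : Metric.sphere (0 : Space n) 1 => inner ℝ u (y : Space n) * ‖F y‖ ^ 2 :=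
  (continuous_const.inner continuous_subtype_val).mul hF.continuous_norm_sq

/-- The Dirichlet integral on the sphere. -/
def sphEnergy (F : Space n → ℂ) : ℝ := ∫ y, ‖gradVec F y‖ ^ 2 ∂(surf n)

/-- The squared `L²` norm on the sphere. -/
def sphMass (F : Space n → ℂ) : ℝ := ∫ y, ‖F y‖ ^ 2 ∂(surf n)

/-- The dipole potential energy on the sphere. -/
def sphDipole (u : Space n) (F : Space n → ℂ) : ℝ :=
  ∫ y, inner ℝ u (y : Space n) * ‖F y‖ ^ 2 ∂(surf n)

lemma sphereForm_eq (hF : IsSphereSmooth F) (u : Space n) (γ : ℝ) :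
    sphereForm u γ F = sphEnergy F + γ * sphDipole u F := by
  have h1 := hF.continuous_gradVec
  unfold sphereForm sphEnergy sphDipole
  rw [← integral_const_mul, ← integral_add (integrable_surf (by fun_prop))
    (integrable_surf ((hF.continuous_dipole u).const_mul γ))]
  exact integral_congr_ae (Eventually.of_forall fun y => by simp only; ring)

lemma sphEnergy_nonneg (F : Space n → ℂ) : 0 ≤ sphEnergy F :=
  integral_nonneg fun _ => sq_nonneg _

lemma sphMass_nonneg (F : Space n → ℂ) : 0 ≤ sphMass F :=
  integral_nonneg fun _ => sq_nonneg _

lemma abs_sphDipole_le (hF : IsSphereSmooth F) {u : Space n} (hu : ‖u‖ = 1) :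
    |sphDipole u F| ≤ sphMass F := by
  refine (abs_integral_le_integral_abs).trans (integral_mono
    (integrable_surf (hF.continuous_dipole u).abs) (integrable_surf hF.continuous_norm_sq) fun y => ?_)
  have h := abs_real_inner_le_norm u (y : Space n)
  have hy : ‖(y : Space n)‖ = 1 := by simp
  rw [hu, hy, mul_one] at h
  simp only [abs_mul, abs_pow, abs_norm]
  exact mul_le_of_le_one_left (sq_nonneg _) h

lemma gradVec_const_mul (c : ℂ) {x : Space n} (hF : DifferentiableAt ℝ F x) :
    gradVec (fun x => c * F x) x = c • gradVec F x := by
  ext i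
  simp only [gradVec, partialDeriv, PiLp.smul_apply, smul_eq_mul]
  rw [fderiv_const_mul hF]
  simp

lemma IsSphereSmooth.const_mul (hF : IsSphereSmooth F) (c : ℂ) :
    IsSphereSmooth fun x => c * F x :=
  ⟨contDiffOn_const.mul hF.contDiffOn, fun r hr x => by rw [hF.homogeneous r hr]⟩

lemma sphEnergy_const_mul (hF : IsSphereSmooth F) (c : ℂ) :
    sphEnergy (fun x => c * F x) = ‖c‖ ^ 2 * sphEnergy F := by
  unfold sphEnergy
  rw [← integral_const_mul]
  refine integral_congr_ae (Eventually.of_forall fun y => ?_)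
  simp only
  rw [gradVec_const_mul c (hF.differentiableAt (ne_zero_of_sphere y)), norm_smul, mul_pow]

lemma sphMass_const_mul (c : ℂ) :
    sphMass (fun x => c * F x) = ‖c‖ ^ 2 * sphMass F := by
  simp only [sphMass, norm_mul, mul_pow, integral_const_mul]

lemma sphDipole_const_mul (u : Space n) (c : ℂ) :
    sphDipole u (fun x => c * F x) = ‖c‖ ^ 2 * sphDipole u F := by
  unfold sphDipole
  rw [← integral_const_mul]
  refine integral_congr_ae (Eventually.of_forall fun y => ?_)
  simp only [norm_mul, mul_pow]; ring

lemma isSphereSmooth_const (c : ℂ) : IsSphereSmooth (fun _ : Space n => c) :=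
  ⟨contDiffOn_const, fun _ _ _ => rfl⟩

lemma surf_real_univ_pos [Nonempty (Fin n)] : 0 < (surf n).real Set.univ := by
  have : surf n ≠ 0 := Measure.toSphere_ne_zero _
  rw [Measure.real, ENNReal.toReal_pos_iff]
  exact ⟨Measure.measure_univ_pos.2 this, measure_lt_top _ _⟩

lemma exists_normalized {F : Space n → ℂ} (h : 0 < sphMass F) :
    ∃ c : ℂ, ‖c‖ ^ 2 = (sphMass F)⁻¹ ∧ sphMass (fun x => c * F x) = 1 := by
  have hc : ‖((Real.sqrt (sphMass F)⁻¹ : ℝ) : ℂ)‖ ^ 2 = (sphMass F)⁻¹ := by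
    rw [Complex.norm_real, Real.norm_eq_abs, sq_abs, Real.sq_sqrt (by positivity)]
  exact ⟨_, hc, by rw [sphMass_const_mul, hc, inv_mul_cancel₀ h.ne']⟩

/-- The values of the quadratic form on normalized functions. -/
def formValues (u : Space n) (γ : ℝ) : Set ℝ :=
  {q : ℝ | ∃ F : Space n → ℂ, IsSphereSmooth F ∧ sphMass F = 1 ∧ q = sphereForm u γ F}

lemma formValues_nonempty [Nonempty (Fin n)] (u : Space n) (γ : ℝ) :
    (formValues u γ).Nonempty := by
  have h : 0 < sphMass (fun _ : Space n => (1 : ℂ)) := by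
    simpa [sphMass] using surf_real_univ_pos
  obtain ⟨c, -, hc⟩ := exists_normalized h
  exact ⟨_, _, (isSphereSmooth_const 1).const_mul c, hc, rfl⟩

/-- Without this bound `sInf` would take its default value `0` and carry no information; it holds
because `|(u, ω)| ≤ 1`. -/
lemma formValues_bddBelow {u : Space n} (hu : ‖u‖ = 1) (γ : ℝ) :
    BddBelow (formValues u γ) := by
  refine ⟨-|γ|, ?_⟩
  rintro q ⟨F, hF, hm, rfl⟩
  rw [sphereForm_eq hF]
  have h1 := abs_sphDipole_le hF hu
  rw [hm] at h1
  have h2 : |γ * sphDipole u F| ≤ |γ| := by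
    rw [abs_mul]; exact mul_le_of_le_one_right (abs_nonneg _) h1
  linarith [neg_abs_le (γ * sphDipole u F), sphEnergy_nonneg F]

lemma lowestEigenvalue_le {u : Space n} (hu : ‖u‖ = 1) (γ : ℝ) (hF : IsSphereSmooth F)
    (hm : sphMass F = 1) : lowestEigenvalue u γ ≤ sphEnergy F + γ * sphDipole u F := by
  rw [← sphereForm_eq hF]
  exact csInf_le (formValues_bddBelow hu γ) ⟨F, hF, hm, rfl⟩

lemma le_lowestEigenvalue [Nonempty (Fin n)] {u : Space n} {γ c : ℝ}
    (h : ∀ F : Space n → ℂ, IsSphereSmooth F → sphMass F = 1 →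
      c ≤ sphEnergy F + γ * sphDipole u F) : c ≤ lowestEigenvalue u γ := by
  refine le_csInf (formValues_nonempty u γ) ?_
  rintro q ⟨F, hF, hm, rfl⟩
  rw [sphereForm_eq hF]
  exact h F hF hm

/-- Homogeneous form of the variational bound, usable without normalization. Zero mass cannot be
normalized; there the dipole term vanishes and only the nonnegative energy remains. -/
lemma lowestEigenvalue_mul_mass_le {u : Space n} (hu : ‖u‖ = 1) (γ : ℝ) (hF : IsSphereSmooth F) :
    lowestEigenvalue u γ * sphMass F ≤ sphEnergy F + γ * sphDipole u F := by
  rcases (sphMass_nonneg F).eq_or_lt with h | h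
  · have h1 := abs_sphDipole_le hF hu
    rw [← h] at h1
    rw [← h, abs_nonpos_iff.1 h1]
    simpa using sphEnergy_nonneg F
  · obtain ⟨c, hc, hm⟩ := exists_normalized h
    have := lowestEigenvalue_le hu γ (hF.const_mul c) hm
    rw [sphEnergy_const_mul hF, sphDipole_const_mul, hc] at this
    rw [← le_div_iff₀ h]
    refine this.trans (le_of_eq ?_)
    field_simp

/-! ### Rotation invariance -/

/-- The real and imaginary parts of `L` are represented by Riesz vectors, and Parseval identifies
each sum with their squared norms, whatever the basis. -/
lemma sum_norm_sq_orthonormal (L : Space n →L[ℝ] ℂ) (b c : OrthonormalBasis (Fin n) ℝ (Space n)) :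
    ∑ i, ‖L (b i)‖ ^ 2 = ∑ i, ‖L (c i)‖ ^ 2 := by
  have h : ∀ b : OrthonormalBasis (Fin n) ℝ (Space n), ∑ i, ‖L (b i)‖ ^ 2 =
      ‖(InnerProductSpace.toDual ℝ (Space n)).symm (Complex.reCLM ∘L L)‖ ^ 2 +
      ‖(InnerProductSpace.toDual ℝ (Space n)).symm (Complex.imCLM ∘L L)‖ ^ 2 := by
    intro b
    rw [← b.sum_sq_norm_inner_left, ← b.sum_sq_norm_inner_left, ← Finset.sum_add_distrib]
    refine Finset.sum_congr rfl fun i _ => ?_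
    simp only [InnerProductSpace.toDual_symm_apply, Real.norm_eq_abs, sq_abs]
    rw [Complex.sq_norm, Complex.normSq_apply]
    simp [sq]
  rw [h b, h c]

lemma norm_gradVec_comp (A : Space n ≃ₗᵢ[ℝ] Space n) (x : Space n)
    (hF : DifferentiableAt ℝ F (A x)) : ‖gradVec (F ∘ A) x‖ ^ 2 = ‖gradVec F (A x)‖ ^ 2 := by
  rw [gradVec_eq_gradOf, gradVec_eq_gradOf, norm_gradOf_sq, norm_gradOf_sq]
  have h : fderiv ℝ (F ∘ A) x = (fderiv ℝ F (A x)).comp (A : Space n →L[ℝ] Space n) :=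
    (hF.hasFDerivAt.comp x A.toContinuousLinearEquiv.hasFDerivAt).fderiv
  rw [h]
  simpa using sum_norm_sq_orthonormal (fderiv ℝ F (A x))
    ((EuclideanSpace.basisFun (Fin n) ℝ).map A) (EuclideanSpace.basisFun (Fin n) ℝ)

/-- The action of a linear isometry on the unit sphere. -/
def sphereMap (A : Space n ≃ₗᵢ[ℝ] Space n) (y : Metric.sphere (0 : Space n) 1) :
    Metric.sphere (0 : Space n) 1 := ⟨A y, by simp⟩

lemma continuous_sphereMap (A : Space n ≃ₗᵢ[ℝ] Space n) : Continuous (sphereMap A) :=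
  (A.continuous.comp continuous_subtype_val).subtype_mk _

-- The surface measure of a set is a multiple of the volume of the cone over it, and an isometry
-- maps cones to cones and preserves volume.
open scoped Pointwise in
lemma measurePreserving_sphereMap (A : Space n ≃ₗᵢ[ℝ] Space n) :
    MeasurePreserving (sphereMap A) (surf n) (surf n) := by
  refine ⟨(continuous_sphereMap A).measurable, ?_⟩
  ext s hs
  rw [Measure.map_apply (continuous_sphereMap A).measurable hs, Measure.toSphere_apply' _ hs,
    Measure.toSphere_apply' _ ((continuous_sphereMap A).measurable hs)]
  congr 1
  have h : (Set.Ioo (0 : ℝ) 1 • ((↑) '' (sphereMap A ⁻¹' s) : Set (Space n))) =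
      A ⁻¹' (Set.Ioo (0 : ℝ) 1 • ((↑) '' s : Set (Space n))) := by
    ext x
    simp only [Set.mem_smul, Set.mem_image, Set.mem_preimage]
    constructor
    · rintro ⟨r, hr, _, ⟨y, hy, rfl⟩, rfl⟩
      exact ⟨r, hr, _, ⟨_, hy, rfl⟩, by simp [sphereMap]⟩
    · rintro ⟨r, hr, _, ⟨y, hy, rfl⟩, h⟩
      refine ⟨r, hr, _, ⟨sphereMap A.symm y, by simpa [sphereMap] using hy, rfl⟩, ?_⟩
      apply A.injective
      rw [← h]; simp [sphereMap]
  rw [h]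
  exact A.measurePreserving.measure_preimage_equiv (f := A.toMeasurableEquiv) _

lemma integral_sphereMap (A : Space n ≃ₗᵢ[ℝ] Space n) {h : Metric.sphere (0 : Space n) 1 → ℝ}
    (hh : Continuous h) : ∫ y, h (sphereMap A y) ∂(surf n) = ∫ y, h y ∂(surf n) := by
  conv_rhs => rw [← (measurePreserving_sphereMap A).map_eq]
  rw [integral_map (continuous_sphereMap A).aemeasurable hh.aestronglyMeasurable]

lemma IsSphereSmooth.comp (hF : IsSphereSmooth F) (A : Space n ≃ₗᵢ[ℝ] Space n) :
    IsSphereSmooth (F ∘ A) :=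
  ⟨hF.contDiffOn.comp A.contDiff.contDiffOn fun x hx => by simpa using hx,
    fun r hr x => by simp [hF.homogeneous r hr]⟩

lemma lowestEigenvalue_le_of_isometry [Nonempty (Fin n)] {u : Space n} (hu : ‖u‖ = 1) (γ : ℝ)
    (A : Space n ≃ₗᵢ[ℝ] Space n) : lowestEigenvalue u γ ≤ lowestEigenvalue (A u) γ := by
  refine le_lowestEigenvalue fun F hF hm => ?_
  have h1 := hF.continuous_gradVec
  have e1 : sphEnergy (F ∘ A) = sphEnergy F := by
    unfold sphEnergy
    rw [← integral_sphereMap A (by fun_prop : Continuous fun y : Metric.sphere (0 : Space n) 1 =>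
      ‖gradVec F y‖ ^ 2)]
    exact integral_congr_ae (Eventually.of_forall fun y => norm_gradVec_comp A _
      (hF.differentiableAt (by simpa using ne_zero_of_sphere y)))
  have e2 : sphMass (F ∘ A) = sphMass F := by
    unfold sphMass
    rw [← integral_sphereMap A hF.continuous_norm_sq]
    rfl
  have e3 : sphDipole u (F ∘ A) = sphDipole (A u) F := by
    unfold sphDipole
    rw [← integral_sphereMap A (hF.continuous_dipole (A u))]
    exact integral_congr_ae (Eventually.of_forall fun y => by simp [sphereMap])
  rw [← e1, ← e3]
  exact lowestEigenvalue_le hu γ (hF.comp A) (e2.trans hm)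

/-- The reflection in the hyperplane orthogonal to `u - v` maps `u` to `v`. -/
lemma lowestEigenvalue_eq_of_norm [Nonempty (Fin n)] {u v : Space n} (hu : ‖u‖ = 1) (hv : ‖v‖ = 1)
    (γ : ℝ) : lowestEigenvalue u γ = lowestEigenvalue v γ := by
  have h : ∀ {u v : Space n}, ‖u‖ = 1 → ‖v‖ = 1 → lowestEigenvalue u γ ≤ lowestEigenvalue v γ := by
    intro u v hu hv
    have := lowestEigenvalue_le_of_isometry hu γ ((Submodule.span ℝ {u - v})ᗮ.reflection)
    rwa [Submodule.reflection_sub (hu.trans hv.symm)] at this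
  exact le_antisymm (h hu hv) (h hv hu)

/-! ### Dependence of the lowest eigenvalue on the coupling constant -/

/-- The integrand is odd under the antipodal map. -/
lemma sphDipole_const [Nonempty (Fin n)] (u : Space n) (c : ℂ) :
    sphDipole u (fun _ => c) = 0 := by
  have h := integral_sphereMap (LinearIsometryEquiv.neg ℝ) (by fun_prop : Continuous
    fun y : Metric.sphere (0 : Space n) 1 => inner ℝ u (y : Space n) * ‖c‖ ^ 2)
  simp only [sphereMap, LinearIsometryEquiv.coe_neg, inner_neg_right, neg_mul,
    integral_neg] at h
  unfold sphDipole
  linarith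

lemma lowestEigenvalue_nonpos [Nonempty (Fin n)] {u : Space n} (hu : ‖u‖ = 1) (γ : ℝ) :
    lowestEigenvalue u γ ≤ 0 := by
  have h : 0 < sphMass (fun _ : Space n => (1 : ℂ)) := by
    simpa [sphMass] using surf_real_univ_pos
  obtain ⟨c, -, hc⟩ := exists_normalized h
  have := lowestEigenvalue_le hu γ ((isSphereSmooth_const 1).const_mul c) hc
  rw [sphDipole_const_mul, sphDipole_const] at this
  refine this.trans (le_of_eq ?_)
  simp [sphEnergy, gradVec_eq_gradOf]

/-- A trace of the concavity of the eigenvalue in `γ`: for each trial function the two sides differ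
by `(1 - t)` times the nonnegative energy. It replaces strict monotonicity when locating the
critical coupling. -/
lemma mul_lowestEigenvalue_le [Nonempty (Fin n)] {u : Space n} (hu : ‖u‖ = 1) (γ : ℝ) {t : ℝ}
    (ht0 : 0 ≤ t) (ht1 : t ≤ 1) : t * lowestEigenvalue u γ ≤ lowestEigenvalue u (t * γ) := by
  refine le_lowestEigenvalue fun F hF hm => ?_
  have := mul_le_mul_of_nonneg_left (lowestEigenvalue_le hu γ hF hm) ht0
  have := mul_nonneg (sub_nonneg.2 ht1) (sphEnergy_nonneg F)
  nlinarith

/-- An infimum of affine functions of `γ` whose slopes are bounded by `1` for normalized trial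
functions. -/
lemma lowestEigenvalue_lipschitz [Nonempty (Fin n)] {u : Space n} (hu : ‖u‖ = 1) :
    LipschitzWith 1 (lowestEigenvalue u) := by
  refine LipschitzWith.of_le_add fun γ γ' => ?_
  rw [← sub_le_iff_le_add]
  refine le_lowestEigenvalue fun F hF hm => ?_
  have h1 := lowestEigenvalue_le hu γ hF hm
  have h2 := abs_sphDipole_le hF hu
  rw [hm] at h2
  have h3 : |(γ - γ') * sphDipole u F| ≤ dist γ γ' := by
    rw [abs_mul, Real.dist_eq]; exact mul_le_of_le_one_right (abs_nonneg _) h2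
  linarith [le_abs_self ((γ - γ') * sphDipole u F)]

lemma exists_sphDipole_neg [Nonempty (Fin n)] {u : Space n} (hu : ‖u‖ = 1) :
    ∃ F : Space n → ℂ, IsSphereSmooth F ∧ sphMass F = 1 ∧ sphDipole u F < 0 := by
  -- A function larger on the side opposite to `u`. With `τ = (u, ω)`, averaging `τ (2 - τ)²` with
  -- its antipodal value leaves `-4 τ²`, which has negative integral.
  set F : Space n → ℂ := fun x => ((2 - inner ℝ u x / ‖x‖ : ℝ) : ℂ) with hFdef
  have hF : IsSphereSmooth F := by
    constructor
    · intro x hx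
      have h1 : ContDiffAt ℝ ∞ (fun x : Space n => ‖x‖) x := contDiffAt_norm ℝ hx
      have h2 : ContDiffAt ℝ ∞ (fun x : Space n => 2 - inner ℝ u x / ‖x‖) x :=
        contDiffAt_const.sub ((contDiffAt_const.inner ℝ contDiffAt_id).div h1 (norm_ne_zero_iff.2 hx))
      exact (Complex.ofRealCLM.contDiff.contDiffAt.comp x h2).contDiffWithinAt
    · intro r hr x
      simp only [hFdef, inner_smul_right, norm_smul, Real.norm_eq_abs, abs_of_pos hr]
      rw [mul_div_mul_left _ _ hr.ne']
  have hD : sphDipole u F < 0 := by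
    have hc : Continuous fun y : Metric.sphere (0 : Space n) 1 =>
      inner ℝ u (y : Space n) * (2 - inner ℝ u (y : Space n)) ^ 2 := by fun_prop
    have hc2 : Continuous fun y : Metric.sphere (0 : Space n) 1 =>
      (inner ℝ u (y : Space n)) ^ 2 := by fun_prop
    have e : sphDipole u F = ∫ y, inner ℝ u (y : Space n) * (2 - inner ℝ u (y : Space n)) ^ 2
        ∂(surf n) := by
      refine integral_congr_ae (Eventually.of_forall fun y => ?_)
      have hy : ‖(y : Space n)‖ = 1 := by simp
      simp only [hFdef, hy, div_one, Complex.norm_real, Real.norm_eq_abs, sq_abs]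
    have h := integral_sphereMap (LinearIsometryEquiv.neg ℝ) hc
    have h2 : sphDipole u F + sphDipole u F = -8 * ∫ y, (inner ℝ u (y : Space n)) ^ 2 ∂(surf n) := by
      rw [e]
      nth_rewrite 1 [← h]
      have hc' : Continuous fun y : Metric.sphere (0 : Space n) 1 =>
        inner ℝ u ((sphereMap (LinearIsometryEquiv.neg ℝ) y : _) : Space n) *
          (2 - inner ℝ u ((sphereMap (LinearIsometryEquiv.neg ℝ) y : _) : Space n)) ^ 2 :=
        hc.comp (continuous_sphereMap _)
      rw [← integral_add (integrable_surf hc') (integrable_surf hc),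
        ← integral_const_mul]
      refine integral_congr_ae (Eventually.of_forall fun y => ?_)
      simp only [sphereMap, LinearIsometryEquiv.coe_neg, inner_neg_right]
      ring
    have h3 : 0 < ∫ y, (inner ℝ u (y : Space n)) ^ 2 ∂(surf n) := by
      refine hc2.integral_pos_of_hasCompactSupport_nonneg_nonzero
        (HasCompactSupport.of_compactSpace _) (fun _ => sq_nonneg _)
        (x := ⟨u, by simpa using hu⟩) ?_
      simp [hu]
    linarith
  have hm : 0 < sphMass F := by
    have := abs_sphDipole_le hF hu
    linarith [abs_pos.2 hD.ne]
  obtain ⟨c, hc, hcm⟩ := exists_normalized hm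
  refine ⟨_, hF.const_mul c, hcm, ?_⟩
  rw [sphDipole_const_mul, hc]
  exact mul_neg_of_pos_of_neg (by positivity) hD

/-- The critical coupling constant at which the lowest eigenvalue reaches `-K`. -/
lemma exists_critical [Nonempty (Fin n)] {K : ℝ} (hK : 0 < K) :
    ∃ γc : ℝ, 0 < γc ∧ ∀ u : Space n, ‖u‖ = 1 → ∀ γ : ℝ, 0 ≤ γ →
      (lowestEigenvalue u γ = -K ↔ γ = γc) ∧ (-K ≤ lowestEigenvalue u γ ↔ γ ≤ γc) := by
  obtain ⟨v, hv⟩ := exists_norm_eq (Space n) (zero_le_one' ℝ)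
  have h0 : lowestEigenvalue v 0 = 0 := by
    refine le_antisymm (lowestEigenvalue_nonpos hv 0) (le_lowestEigenvalue fun F hF hm => ?_)
    simpa using sphEnergy_nonneg F
  obtain ⟨F, hF, hm, hD⟩ := exists_sphDipole_neg hv
  -- The coupling at which the chosen trial function has form value exactly `-K`; the eigenvalue is
  -- therefore at most `-K` there.
  set Γ := (sphEnergy F + K) / (-sphDipole v F) with hΓ
  have hΓ0 : 0 ≤ Γ := div_nonneg (by linarith [sphEnergy_nonneg F]) (by linarith)
  have h1 : lowestEigenvalue v Γ ≤ -K := by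
    refine (lowestEigenvalue_le hv Γ hF hm).trans (le_of_eq ?_)
    have := hD.ne
    rw [hΓ]; field_simp; ring
  obtain ⟨γc, ⟨hc0, -⟩, hc⟩ := intermediate_value_Icc' hΓ0
    (lowestEigenvalue_lipschitz hv).continuous.continuousOn
    (show -K ∈ Set.Icc _ _ from ⟨h1, by rw [h0]; linarith⟩)
  have hcpos : 0 < γc := by
    refine hc0.lt_of_ne ?_
    rintro rfl
    linarith
  refine ⟨γc, hcpos, fun u hu γ hγ => ?_⟩
  rw [lowestEigenvalue_eq_of_norm hu hv]
  have hle : γ ≤ γc → γ / γc * -K ≤ lowestEigenvalue v γ := by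
    intro h
    have := mul_lowestEigenvalue_le hv γc (div_nonneg hγ hc0) ((div_le_one hcpos).2 h)
    rwa [hc, div_mul_cancel₀ _ hcpos.ne'] at this
  -- Scaling `γ` down to `γc` gives `λ_γ ≤ -K γ/γc`, strictly below `-K`.
  have hgt : γc < γ → lowestEigenvalue v γ < -K := by
    intro h
    have hγ' : 0 < γ := hcpos.trans h
    have := mul_lowestEigenvalue_le hv γ (div_nonneg hc0 hγ) ((div_le_one hγ').2 h.le)
    rw [div_mul_cancel₀ _ hγ'.ne', hc, div_mul_eq_mul_div, div_le_iff₀ hγ'] at this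
    nlinarith
  refine ⟨⟨fun h => ?_, fun h => h ▸ hc⟩, fun h => ?_, fun h => ?_⟩
  · rcases lt_trichotomy γ γc with h' | h' | h'
    · have h2 := hle h'.le
      have : γ / γc < 1 := (div_lt_one hcpos).2 h'
      rw [h] at h2
      nlinarith
    · exact h'
    · linarith [hgt h']
  · by_contra h'
    linarith [hgt (not_le.1 h')]
  · have : γ / γc ≤ 1 := (div_le_one hcpos).2 h
    nlinarith [hle h]

/-! ### Restriction of a function to a sphere -/

/-- The restriction of `f` to the sphere of radius `r`, extended homogeneously. -/
def shell (f : Space n → ℂ) (r : ℝ) (x : Space n) : ℂ := f ((r / ‖x‖) • x)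

lemma shell_sphere (f : Space n → ℂ) (r : ℝ) (y : Metric.sphere (0 : Space n) 1) :
    shell f r y = f (r • (y : Space n)) := by
  simp [shell]

lemma isSphereSmooth_shell {f : Space n → ℂ} (hf : ContDiff ℝ ∞ f) (r : ℝ) :
    IsSphereSmooth (shell f r) := by
  constructor
  · intro x hx
    have h1 : ContDiffAt ℝ ∞ (fun x : Space n => ‖x‖) x := contDiffAt_norm ℝ hx
    exact (hf.contDiffAt.comp x ((contDiffAt_const.div h1 (norm_ne_zero_iff.2 hx)).smul
      contDiffAt_id)).contDiffWithinAt
  · intro s hs x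
    simp only [shell, norm_smul, Real.norm_eq_abs, abs_of_pos hs, smul_smul]
    rcases eq_or_ne x 0 with rfl | hx
    · simp
    · have := norm_ne_zero_iff.2 hx
      congr 2
      field_simp

lemma hasFDerivAt_norm_of_ne {x : Space n} (hx : x ≠ 0) :
    HasFDerivAt (fun x : Space n => ‖x‖) (‖x‖⁻¹ • innerSL ℝ x) x := by
  have h := (hasStrictFDerivAt_norm_sq x).hasFDerivAt.sqrt (by positivity)
  simp only [Real.sqrt_sq (norm_nonneg _)] at h
  refine h.congr_fderiv ?_
  ext v
  have := norm_ne_zero_iff.2 hx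
  simp
  field_simp

/-- At a unit vector `y` the derivative of `x ↦ (r/|x|) x` is `r` times the projection onto the
tangent space, so the spherical gradient is `r` times the tangential part of `∇f(ry)`; Pythagoras
then gives the polar splitting. -/
lemma gradVec_shell {f : Space n → ℂ} {r : ℝ} (y : Metric.sphere (0 : Space n) 1)
    (hf : DifferentiableAt ℝ f (r • (y : Space n))) :
    ‖gradVec (shell f r) y‖ ^ 2 + ‖fderiv ℝ f (r • (y : Space n)) (r • (y : Space n))‖ ^ 2 =
      r ^ 2 * ‖gradVec f (r • (y : Space n))‖ ^ 2 := by
  have hy : ‖(y : Space n)‖ = 1 := by simp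
  have hy0 := ne_zero_of_sphere y
  have h1 : HasFDerivAt (fun x : Space n => (r / ‖x‖) • x)
      (r • (ContinuousLinearMap.id ℝ (Space n) - (innerSL ℝ (y : Space n)).smulRight (y : Space n)))
      (y : Space n) := by
    have h := ((hasDerivAt_inv (norm_ne_zero_iff.2 hy0)).comp_hasFDerivAt _
      (hasFDerivAt_norm_of_ne hy0)).const_mul r |>.smul (hasFDerivAt_id (y : Space n))
    refine h.congr_fderiv ?_
    ext v i
    simp [hy]
    ring
  have h2 : fderiv ℝ (shell f r) y = (fderiv ℝ f (r • (y : Space n))).comp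
      (r • (ContinuousLinearMap.id ℝ (Space n) -
        (innerSL ℝ (y : Space n)).smulRight (y : Space n))) := by
    refine HasFDerivAt.fderiv ?_
    refine HasFDerivAt.comp (g := f) (y : Space n) ?_ h1
    rw [hy, div_one]
    exact hf.hasFDerivAt
  have h3 := norm_gradOf_tangential_sq (r • fderiv ℝ f (r • (y : Space n)))
    (fderiv ℝ (shell f r) y) y hy (by intro v; rw [h2]; simp; ring)
  rw [gradVec_eq_gradOf, gradVec_eq_gradOf, map_smul (fderiv ℝ f _), ← smul_apply,
    h3, map_smul, norm_smul, mul_pow, Real.norm_eq_abs, sq_abs]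

end Sphere

/-! ### The inequality for test functions -/

section TestFunctions

variable {n : ℕ} {f : Space n → ℂ}

/-- The operator `x · ∇ + (n - 2) / 2`, which annihilates `|x|^(-(n-2)/2)`. -/
def eulerOp (f : Space n → ℂ) (x : Space n) : ℂ :=
  fderiv ℝ f x x + (((n : ℝ) - 2) / 2) • f x

lemma continuous_fderiv_self (hf : ContDiff ℝ ∞ f) : Continuous fun x => fderiv ℝ f x x :=
  (hf.continuous_fderiv (by simp)).clm_apply continuous_id

lemma continuous_gradVec (hf : ContDiff ℝ ∞ f) : Continuous (gradVec f) :=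
  continuous_gradOf.comp (hf.continuous_fderiv (by simp))

lemma hasCompactSupport_gradVec (hs : HasCompactSupport f) : HasCompactSupport (gradVec f) :=
  (hs.fderiv (𝕜 := ℝ)).comp_left (g := gradOf) (map_zero _)

lemma hasCompactSupport_fderiv_self (hs : HasCompactSupport f) :
    HasCompactSupport fun x => fderiv ℝ f x x := by
  refine (hs.fderiv (𝕜 := ℝ)).mono fun x hx => ?_
  simp only [Function.mem_support] at hx ⊢
  intro h
  simp [h] at hx

lemma hasCompactSupport_norm_sq {V : Type*} [NormedAddCommGroup V] {f : Space n → V}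
    (hs : HasCompactSupport f) :
    HasCompactSupport fun x => ‖f x‖ ^ 2 :=
  hs.comp_left (g := fun z : V => ‖z‖ ^ 2) (by simp)

lemma integrable_norm_gradVec_sq (hf : ContDiff ℝ ∞ f) (hs : HasCompactSupport f) :
    Integrable fun x => ‖gradVec f x‖ ^ 2 :=
  ((continuous_gradVec hf).norm.pow 2).integrable_of_hasCompactSupport
    (hasCompactSupport_norm_sq (hasCompactSupport_gradVec hs))

lemma integrable_norm_sq_div (hn : 3 ≤ n) {V : Type*} [NormedAddCommGroup V] {g : Space n → V}
    (hg : Continuous g) (hs : HasCompactSupport g) :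
    Integrable fun x => ‖g x‖ ^ 2 / ‖x‖ ^ 2 := by
  have h2 : Continuous fun x => ‖g x‖ ^ 2 := by fun_prop
  refine integrable_div_sq hn h2 (hasCompactSupport_norm_sq hs)
    (h2.measurable.div (by fun_prop)) fun x => ?_
  rw [abs_div, abs_of_nonneg (sq_nonneg ‖x‖)]

lemma dipoleDensity_abs_le {u : Space n} (hu : ‖u‖ = 1) (f : Space n → ℂ) (x : Space n) :
    |dipoleDensity u f x| ≤ ‖f x‖ ^ 2 / ‖x‖ ^ 2 := by
  unfold dipoleDensity
  rcases eq_or_ne x 0 with rfl | hx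
  · simp
  have h := abs_real_inner_le_norm u x
  rw [hu, one_mul] at h
  have hx' : 0 < ‖x‖ := norm_pos_iff.2 hx
  rw [abs_mul, abs_div, abs_pow, abs_norm, abs_pow, abs_norm]
  calc |inner ℝ u x| / ‖x‖ ^ 3 * ‖f x‖ ^ 2 ≤ ‖x‖ / ‖x‖ ^ 3 * ‖f x‖ ^ 2 := by gcongr
    _ = _ := by field_simp

lemma integrable_dipoleDensity (hn : 3 ≤ n) {u : Space n} (hu : ‖u‖ = 1)
    (hf : Continuous f) (hs : HasCompactSupport f) : Integrable (dipoleDensity u f) := by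
  have h2 : Continuous fun x => ‖f x‖ ^ 2 := by fun_prop
  refine integrable_div_sq hn h2 (hasCompactSupport_norm_sq hs) ?_ fun x => ?_
  · have := hf.measurable
    unfold dipoleDensity
    fun_prop
  · rw [abs_of_nonneg (sq_nonneg ‖f x‖)]
    exact dipoleDensity_abs_le hu f x

lemma fderiv_norm_sq_self (hf : ContDiff ℝ ∞ f) (x : Space n) :
    fderiv ℝ (fun x => ‖f x‖ ^ 2) x x = 2 * inner ℝ (f x) (fderiv ℝ f x x) := by
  have h : DifferentiableAt ℝ f x := hf.differentiable (by simp) x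
  rw [h.hasFDerivAt.norm_sq.fderiv]
  simp
  ring

lemma integrable_inner_div (hn : 3 ≤ n) (hf : ContDiff ℝ ∞ f) (hs : HasCompactSupport f) :
    Integrable fun x => inner ℝ (f x) (fderiv ℝ f x x) / ‖x‖ ^ 2 := by
  have hc : Continuous fun x => inner ℝ (f x) (fderiv ℝ f x x) :=
    hf.continuous.inner (continuous_fderiv_self hf)
  refine integrable_div_sq hn hc ?_ (hc.measurable.div (by fun_prop)) fun x => ?_
  · refine hs.mono fun x hx => ?_
    simp only [Function.mem_support] at hx ⊢
    intro h
    simp [h] at hx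
  · rw [abs_div, abs_of_nonneg (sq_nonneg ‖x‖)]

lemma pow_sub_two_div (hn : 3 ≤ n) (r : ℝ) : r ^ (n - 2) / r ^ n = (r ^ 2)⁻¹ := by
  rcases eq_or_ne r 0 with rfl | hr
  · rw [zero_pow (by omega), zero_pow (by omega)]; simp
  · have : n = (n - 2) + 2 := by omega
    rw [div_eq_iff (pow_ne_zero _ hr)]
    conv_rhs => rw [this, pow_add]
    field_simp

/-- The radial divergence theorem with `k = |f|²` and `m = n - 2`: the weight becomes `|x|⁻²`, and
`m ≥ 1` again uses `n ≥ 3`. -/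
lemma integral_inner_div (hn : 3 ≤ n) (hf : ContDiff ℝ ∞ f) (hs : HasCompactSupport f) :
    ∫ x, inner ℝ (f x) (fderiv ℝ f x x) / ‖x‖ ^ 2 =
      -(((n : ℝ) - 2) / 2 * ∫ x, ‖f x‖ ^ 2 / ‖x‖ ^ 2) := by
  have : Nonempty (Fin n) := ⟨⟨0, by omega⟩⟩
  have i1 := integrable_inner_div hn hf hs
  have i2 := integrable_norm_sq_div hn hf.continuous hs
  have hcast : ((n - 2 : ℕ) : ℝ) = (n : ℝ) - 2 := by
    rw [Nat.cast_sub (by omega)]; norm_num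
  have e : (fun x => (fderiv ℝ (fun x => ‖f x‖ ^ 2) x x + (n - 2 : ℕ) * ‖f x‖ ^ 2) *
      (‖x‖ ^ (n - 2) / ‖x‖ ^ n)) = fun x =>
      2 * (inner ℝ (f x) (fderiv ℝ f x x) / ‖x‖ ^ 2) +
      ((n : ℝ) - 2) * (‖f x‖ ^ 2 / ‖x‖ ^ 2) := by
    ext x
    rw [fderiv_norm_sq_self hf, pow_sub_two_div hn, hcast]
    simp only [div_eq_mul_inv]; ring
  have h := integral_radial_divergence (m := n - 2) (by omega)
    ((hf.norm_sq ℝ).of_le (by simp)) (hasCompactSupport_norm_sq hs)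
    (by rw [e]; exact (i1.const_mul 2).add (i2.const_mul _))
  rw [e, integral_add (i1.const_mul 2) (i2.const_mul _), integral_const_mul,
    integral_const_mul] at h
  linarith

lemma continuous_eulerOp (hf : ContDiff ℝ ∞ f) : Continuous (eulerOp f) := by
  have h1 := continuous_fderiv_self hf
  have h2 := hf.continuous
  unfold eulerOp
  fun_prop

lemma hasCompactSupport_eulerOp (hs : HasCompactSupport f) : HasCompactSupport (eulerOp f) :=
  (hasCompactSupport_fderiv_self hs).add
    (hs.comp_left (g := fun z : ℂ => (((n : ℝ) - 2) / 2) • z) (smul_zero _))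

/-- The ground state representation in the radial variable. -/
lemma integral_eulerOp_sq (hn : 3 ≤ n) (hf : ContDiff ℝ ∞ f) (hs : HasCompactSupport f) :
    ∫ x, ‖eulerOp f x‖ ^ 2 / ‖x‖ ^ 2 = (∫ x, ‖fderiv ℝ f x x‖ ^ 2 / ‖x‖ ^ 2) -
      (((n : ℝ) - 2) / 2) ^ 2 * ∫ x, ‖f x‖ ^ 2 / ‖x‖ ^ 2 := by
  have i1 := integrable_inner_div hn hf hs
  have i2 := integrable_norm_sq_div hn hf.continuous hs
  have i3 := integrable_norm_sq_div hn (continuous_fderiv_self hf)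
    (hasCompactSupport_fderiv_self hs)
  have e : (fun x => ‖eulerOp f x‖ ^ 2 / ‖x‖ ^ 2) = fun x =>
      ‖fderiv ℝ f x x‖ ^ 2 / ‖x‖ ^ 2 + ((n : ℝ) - 2) * (inner ℝ (f x) (fderiv ℝ f x x) / ‖x‖ ^ 2) +
      (((n : ℝ) - 2) / 2) ^ 2 * (‖f x‖ ^ 2 / ‖x‖ ^ 2) := by
    ext x
    unfold eulerOp
    rw [norm_add_sq_real, norm_smul, inner_smul_right, real_inner_comm, mul_pow,
      Real.norm_eq_abs, sq_abs]
    ring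
  have i31 : Integrable fun x => ‖fderiv ℝ f x x‖ ^ 2 / ‖x‖ ^ 2 +
      ((n : ℝ) - 2) * (inner ℝ (f x) (fderiv ℝ f x x) / ‖x‖ ^ 2) := i3.add (i1.const_mul _)
  rw [e, integral_add i31 (i2.const_mul _), integral_add i3 (i1.const_mul _), integral_const_mul, integral_const_mul,
    integral_inner_div hn hf hs]
  ring

lemma fderiv_self_div_le (f : Space n → ℂ) (x : Space n) :
    ‖fderiv ℝ f x x‖ ^ 2 / ‖x‖ ^ 2 ≤ ‖gradVec f x‖ ^ 2 := by
  have h := norm_apply_sq_le (fderiv ℝ f x) x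
  exact div_le_of_le_mul₀ (sq_nonneg _) (sq_nonneg _) (by rw [mul_comm]; exact h)

/-- Hardy's inequality for test functions. -/
lemma hardy_testFunction (hn : 3 ≤ n) (hf : ContDiff ℝ ∞ f) (hs : HasCompactSupport f) :
    (((n : ℝ) - 2) / 2) ^ 2 * ∫ x, ‖f x‖ ^ 2 / ‖x‖ ^ 2 ≤ ∫ x, ‖gradVec f x‖ ^ 2 := by
  have h1 := integral_eulerOp_sq hn hf hs
  have h2 : 0 ≤ ∫ x, ‖eulerOp f x‖ ^ 2 / ‖x‖ ^ 2 := integral_nonneg fun x => by positivity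
  have h3 : ∫ x, ‖fderiv ℝ f x x‖ ^ 2 / ‖x‖ ^ 2 ≤ ∫ x, ‖gradVec f x‖ ^ 2 :=
    integral_mono (integrable_norm_sq_div hn (continuous_fderiv_self hf)
      (hasCompactSupport_fderiv_self hs)) (integrable_norm_gradVec_sq hf hs)
      (fderiv_self_div_le f)
  linarith

/-- The dipole inequality for test functions, with the radial remainder term. -/
lemma dipole_testFunction (hn : 3 ≤ n) {u : Space n} (hu : ‖u‖ = 1) {γ : ℝ}
    (hγ : -(((n : ℝ) - 2) / 2) ^ 2 ≤ lowestEigenvalue u γ)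
    (hf : ContDiff ℝ ∞ f) (hs : HasCompactSupport f) :
    ∫ x, ‖eulerOp f x‖ ^ 2 / ‖x‖ ^ 2 ≤
      (∫ x, ‖gradVec f x‖ ^ 2) + γ * ∫ x, dipoleDensity u f x := by
  have : Nonempty (Fin n) := ⟨⟨0, by omega⟩⟩
  have i1 := integrable_norm_gradVec_sq hf hs
  have i2 := integrable_norm_sq_div hn hf.continuous hs
  have i3 := integrable_norm_sq_div hn (continuous_fderiv_self hf)
    (hasCompactSupport_fderiv_self hs)
  have i4 := integrable_dipoleDensity hn hu hf.continuous hs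
  set c : ℝ := ((n : ℝ) - 2) / 2
  have j1 : Integrable fun x => ‖gradVec f x‖ ^ 2 - ‖fderiv ℝ f x x‖ ^ 2 / ‖x‖ ^ 2 := i1.sub i3
  have j2 : Integrable fun x => ‖gradVec f x‖ ^ 2 - ‖fderiv ℝ f x x‖ ^ 2 / ‖x‖ ^ 2 +
      γ * dipoleDensity u f x := j1.add (i4.const_mul γ)
  have j3 : Integrable fun x => ‖gradVec f x‖ ^ 2 - ‖fderiv ℝ f x x‖ ^ 2 / ‖x‖ ^ 2 +
      γ * dipoleDensity u f x + c ^ 2 * (‖f x‖ ^ 2 / ‖x‖ ^ 2) := j2.add (i2.const_mul _)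
  -- After removal of the radial derivative, the integrand on the sphere of radius `r` is `r⁻²`
  -- times the spherical form plus `c²` times the mass, whose integral is nonnegative by the
  -- assumption on the eigenvalue.
  have key : 0 ≤ ∫ x, (‖gradVec f x‖ ^ 2 - ‖fderiv ℝ f x x‖ ^ 2 / ‖x‖ ^ 2 +
      γ * dipoleDensity u f x + c ^ 2 * (‖f x‖ ^ 2 / ‖x‖ ^ 2)) := by
    rw [polar_integral_shell j3]
    refine setIntegral_nonneg measurableSet_Ioi fun r hr => ?_
    have hr : (0 : ℝ) < r := hr
    refine mul_nonneg (by positivity) ?_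
    have hF := isSphereSmooth_shell hf r
    have h := lowestEigenvalue_mul_mass_le hu γ hF
    have hE := hF.continuous_gradVec
    have e : ∫ y, (‖gradVec f (r • (y : Space n))‖ ^ 2 -
        ‖fderiv ℝ f (r • (y : Space n)) (r • (y : Space n))‖ ^ 2 / ‖r • (y : Space n)‖ ^ 2 +
        γ * dipoleDensity u f (r • (y : Space n)) +
        c ^ 2 * (‖f (r • (y : Space n))‖ ^ 2 / ‖r • (y : Space n)‖ ^ 2)) ∂(surf n) =
        (r ^ 2)⁻¹ * (sphEnergy (shell f r) + γ * sphDipole u (shell f r) +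
          c ^ 2 * sphMass (shell f r)) := by
      unfold sphEnergy sphDipole sphMass
      have l1 : Integrable (fun y : Metric.sphere (0 : Space n) 1 =>
          ‖gradVec (shell f r) y‖ ^ 2) (surf n) := integrable_surf (by fun_prop)
      have l2 := (integrable_surf (hF.continuous_dipole u)).const_mul γ
      have l3 : Integrable (fun y : Metric.sphere (0 : Space n) 1 => ‖gradVec (shell f r) y‖ ^ 2 +
          γ * (inner ℝ u (y : Space n) * ‖shell f r y‖ ^ 2)) (surf n) := l1.add l2
      rw [← integral_const_mul, ← integral_const_mul, ← integral_add l1 l2, ← integral_add l3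
        (integrable_surf (hF.continuous_norm_sq.const_mul _)), ← integral_const_mul]
      refine integral_congr_ae (Eventually.of_forall fun y => ?_)
      have hy : ‖(y : Space n)‖ = 1 := by simp
      have hg := gradVec_shell (r := r) y (hf.differentiable (by simp) (r • (y : Space n)))
      have hg' : ‖gradVec f (r • (y : Space n))‖ ^ 2 = (‖gradVec (shell f r) y‖ ^ 2 +
        ‖fderiv ℝ f (r • (y : Space n)) (r • (y : Space n))‖ ^ 2) / r ^ 2 := by
        rw [hg]; field_simp
      simp only [dipoleDensity, shell_sphere, norm_smul, hy, Real.norm_eq_abs, abs_of_pos hr,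
        inner_smul_right, hg']
      field_simp
      ring
    rw [e]
    refine mul_nonneg (by positivity) ?_
    have := mul_le_mul_of_nonneg_right hγ (sphMass_nonneg (shell f r))
    linarith
  rw [integral_add j2 (i2.const_mul _), integral_add j1 (i4.const_mul γ), integral_sub i1 i3, integral_const_mul,
    integral_const_mul] at key
  rw [integral_eulerOp_sq hn hf hs]
  change _ - c ^ 2 * _ ≤ _
  linarith

/-- A weighted `L²` norm is controlled by the radial remainder term. -/
lemma weighted_norm_le (hn : 3 ≤ n) (hf : ContDiff ℝ ∞ f) (hs : HasCompactSupport f) {δ : ℝ}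
    (hδ : 0 < δ) :
    ∫ x, 2 / (1 + ‖x‖ ^ 2) ^ 2 * ‖f x‖ ^ 2 ≤
      δ * (∫ x, ‖f x‖ ^ 2) + δ⁻¹ * ∫ x, ‖eulerOp f x‖ ^ 2 / ‖x‖ ^ 2 := by
  have : Nonempty (Fin n) := ⟨⟨0, by omega⟩⟩
  have hpos : ∀ x : Space n, 1 + ‖x‖ ^ 2 ≠ 0 := fun x => by positivity
  have i1 : Integrable fun x => ‖f x‖ ^ 2 :=
    (hf.continuous.norm.pow 2).integrable_of_hasCompactSupport (hasCompactSupport_norm_sq hs)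
  have i2 := integrable_norm_sq_div hn (continuous_eulerOp hf) (hasCompactSupport_eulerOp hs)
  have hw : Continuous fun x : Space n => 2 / (1 + ‖x‖ ^ 2) ^ 2 :=
    continuous_const.div (by fun_prop) fun x => pow_ne_zero 2 (hpos x)
  have i3 : Integrable fun x => 2 / (1 + ‖x‖ ^ 2) ^ 2 * ‖f x‖ ^ 2 :=
    (hw.mul (hf.continuous.norm.pow 2)).integrable_of_hasCompactSupport
      (hasCompactSupport_norm_sq hs).mul_left
  have hψ : Continuous fun x : Space n => (1 + ‖x‖ ^ 2)⁻¹ :=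
    Continuous.inv₀ (by fun_prop) hpos
  have i4 : Integrable fun x => 2 * (1 + ‖x‖ ^ 2)⁻¹ * inner ℝ (f x) (eulerOp f x) := by
    refine ((continuous_const.mul hψ).mul (hf.continuous.inner
      (continuous_eulerOp hf))).integrable_of_hasCompactSupport (hs.mono fun x hx => ?_)
    simp only [Function.mem_support] at hx ⊢
    intro h
    simp [h] at hx
  -- The multiplier `(1+|x|²)⁻¹` with `m = n`: as `2 Re (f̄ eulerOp f)` carries `(n-2)|f|²`, the
  -- leftover coefficient is `2(1+|x|²)⁻¹ - 2|x|²(1+|x|²)⁻² = 2(1+|x|²)⁻²`.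
  set k : Space n → ℝ := fun x => (1 + ‖x‖ ^ 2)⁻¹ * ‖f x‖ ^ 2 with hk
  have hkd : ContDiff ℝ 1 k := by
    refine ContDiff.mul (ContDiff.inv (contDiff_const.add (contDiff_norm_sq ℝ)) hpos)
      ((hf.norm_sq ℝ).of_le (by simp))
  have hks : HasCompactSupport k := (hasCompactSupport_norm_sq hs).mul_left
  have hfd : ∀ x, fderiv ℝ k x x = -(2 * ‖x‖ ^ 2) / (1 + ‖x‖ ^ 2) ^ 2 * ‖f x‖ ^ 2 +
      (1 + ‖x‖ ^ 2)⁻¹ * (2 * inner ℝ (f x) (fderiv ℝ f x x)) := by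
    intro x
    have d1 : HasFDerivAt (fun x : Space n => 1 + ‖x‖ ^ 2) (2 • innerSL ℝ x) x :=
      (hasStrictFDerivAt_norm_sq x).hasFDerivAt.const_add 1
    have d2 := (hasDerivAt_inv (hpos x)).comp_hasFDerivAt x d1
    have d3 : HasFDerivAt (fun x => ‖f x‖ ^ 2) (fderiv ℝ (fun x => ‖f x‖ ^ 2) x) x :=
      ((hf.norm_sq ℝ).differentiable (by simp) x).hasFDerivAt
    have d4 := d2.mul d3
    have : fderiv ℝ k x = _ := d4.fderiv
    rw [this]
    simp [fderiv_norm_sq_self hf]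
    ring
  -- Only almost everywhere, since `‖x‖ ^ n / ‖x‖ ^ n` is `0` at the origin by the division
  -- convention.
  have e : (fun x => (fderiv ℝ k x x + n * k x) * (‖x‖ ^ n / ‖x‖ ^ n)) =ᵐ[volume] fun x =>
      2 * (1 + ‖x‖ ^ 2)⁻¹ * inner ℝ (f x) (eulerOp f x) +
        2 / (1 + ‖x‖ ^ 2) ^ 2 * ‖f x‖ ^ 2 := by
    filter_upwards [Measure.ae_ne volume (0 : Space n)] with x hx
    rw [div_self (pow_ne_zero _ (norm_ne_zero_iff.2 hx)), hfd, mul_one]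
    simp only [hk, eulerOp, inner_add_right, inner_smul_right, real_inner_self_eq_norm_sq]
    have := hpos x
    field_simp
    ring
  have h := integral_radial_divergence (m := n) (by omega) hkd hks
    ((integrable_congr e).2 (i4.add i3))
  rw [integral_congr_ae e, integral_add i4 i3] at h
  have hle : -∫ x, 2 * (1 + ‖x‖ ^ 2)⁻¹ * inner ℝ (f x) (eulerOp f x) ≤
      ∫ x, (δ * ‖f x‖ ^ 2 + δ⁻¹ * (‖eulerOp f x‖ ^ 2 / ‖x‖ ^ 2)) := by
    rw [← integral_neg]
    refine integral_mono_ae i4.neg ((i1.const_mul _).add (i2.const_mul _)) ?_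
    filter_upwards [Measure.ae_ne volume (0 : Space n)] with x hx
    have hx' : 0 < ‖x‖ := norm_pos_iff.2 hx
    have h1 := (abs_le.1 (abs_real_inner_le_norm (f x) (eulerOp f x))).1
    set a := ‖f x‖
    set b := ‖eulerOp f x‖
    have hψ1 : (1 + ‖x‖ ^ 2)⁻¹ ≤ ‖x‖⁻¹ := by
      apply inv_anti₀ hx'
      nlinarith [sq_nonneg (‖x‖ - 1)]
    have h2 : -(2 * (1 + ‖x‖ ^ 2)⁻¹ * inner ℝ (f x) (eulerOp f x)) ≤ 2 * (‖x‖⁻¹ * (a * b)) := by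
      have h3 : (1 + ‖x‖ ^ 2)⁻¹ * -(inner ℝ (f x) (eulerOp f x)) ≤
          (1 + ‖x‖ ^ 2)⁻¹ * (a * b) :=
        mul_le_mul_of_nonneg_left (by linarith) (by positivity)
      have h4 : (1 + ‖x‖ ^ 2)⁻¹ * (a * b) ≤ ‖x‖⁻¹ * (a * b) :=
        mul_le_mul_of_nonneg_right hψ1 (by positivity)
      linarith
    refine h2.trans ?_
    have h5 : b ^ 2 / ‖x‖ ^ 2 = (‖x‖⁻¹ * b) ^ 2 := by field_simp
    rw [h5]
    -- Young's inequality with parameter `δ` for `|f|` and `|eulerOp f|/|x|`.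
    have h6 := mul_nonneg (inv_nonneg.2 hδ.le) (sq_nonneg (δ * a - ‖x‖⁻¹ * b))
    have h7 : δ⁻¹ * (δ * a - ‖x‖⁻¹ * b) ^ 2 =
        δ * a ^ 2 + δ⁻¹ * (‖x‖⁻¹ * b) ^ 2 - 2 * (‖x‖⁻¹ * (a * b)) := by
      field_simp
      ring
    linarith
  rw [integral_add (i1.const_mul _) (i2.const_mul _), integral_const_mul,
    integral_const_mul] at hle
  linarith

end TestFunctions

/-! ### Passage to the limit -/

section Limits

variable {n : ℕ}

lemma eLpNorm_two_eq {α V : Type*} [MeasurableSpace α] {μ : Measure α} [NormedAddCommGroup V]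
    {g : α → V} (hg : MemLp g 2 μ) :
    eLpNorm g 2 μ = ENNReal.ofReal (√(∫ x, ‖g x‖ ^ 2 ∂μ)) := by
  rw [hg.eLpNorm_eq_integral_rpow_norm two_ne_zero ENNReal.ofNat_ne_top]
  simp [Real.sqrt_eq_rpow]

/-- Convergence holds in `L¹`: `||v|² - |w|²| ≤ |v-w| (|v-w| + 2|w|)`, and Cauchy–Schwarz applies.
One statement serves the gradient, the dipole weight `(u,x)/|x|` and the weighted norm. -/
lemma tendsto_integral_mul_norm_sq {α V : Type*} [MeasurableSpace α] {μ : Measure α}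
    [NormedAddCommGroup V] {v : ℕ → α → V} {w : α → V} {a : α → ℝ}
    (hv : ∀ j, MemLp (v j) 2 μ) (hw : MemLp w 2 μ)
    (h : Tendsto (fun j => eLpNorm (v j - w) 2 μ) atTop (𝓝 0))
    (ham : AEStronglyMeasurable a μ) (ha : ∀ x, |a x| ≤ 1) :
    (∀ u : α → V, MemLp u 2 μ → Integrable (fun x => a x * ‖u x‖ ^ 2) μ) ∧
      Tendsto (fun j => ∫ x, a x * ‖v j x‖ ^ 2 ∂μ) atTop (𝓝 (∫ x, a x * ‖w x‖ ^ 2 ∂μ)) := by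
  have hi : ∀ u : α → V, MemLp u 2 μ → Integrable (fun x => a x * ‖u x‖ ^ 2) μ := by
    intro u hu
    exact (hu.integrable_norm_pow two_ne_zero).bdd_mul ham (Eventually.of_forall ha)
  refine ⟨hi, ?_⟩
  refine tendsto_integral_of_L1' _ (hi w hw).1 (Eventually.of_forall fun j => hi _ (hv j)) ?_
  have hb : ∀ j, eLpNorm ((fun x => a x * ‖v j x‖ ^ 2) - fun x => a x * ‖w x‖ ^ 2) 1 μ ≤
      eLpNorm (v j - w) 2 μ * (eLpNorm (v j - w) 2 μ + 2 * eLpNorm w 2 μ) := by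
    intro j
    have h1 : eLpNorm ((fun x => a x * ‖v j x‖ ^ 2) - fun x => a x * ‖w x‖ ^ 2) 1 μ ≤
        eLpNorm (fun x => ‖(v j - w) x‖ * (‖(v j - w) x‖ + 2 * ‖w x‖)) 1 μ := by
      refine eLpNorm_mono_real fun x => ?_
      simp only [Pi.sub_apply, ← mul_sub, norm_mul, Real.norm_eq_abs]
      refine (mul_le_of_le_one_left (abs_nonneg _) (ha x)).trans ?_
      have h2 := abs_norm_sub_norm_le (v j x) (w x)
      have h3 : ‖v j x‖ ≤ ‖v j x - w x‖ + ‖w x‖ := norm_le_norm_sub_add _ _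
      rw [sq_sub_sq, abs_mul, mul_comm, abs_of_nonneg (by positivity : 0 ≤ ‖v j x‖ + ‖w x‖)]
      exact mul_le_mul h2 (by linarith) (by positivity) (norm_nonneg _)
    refine h1.trans ?_
    have h4 : AEStronglyMeasurable (fun x => ‖(v j - w) x‖) μ := ((hv j).sub hw).1.norm
    have h5 : AEStronglyMeasurable (fun x => ‖(v j - w) x‖ + 2 * ‖w x‖) μ :=
      h4.add (hw.1.norm.const_mul 2)
    refine (eLpNorm_smul_le_mul_eLpNorm (p := 2) (q := 2) (r := 1) h5 h4).trans ?_
    rw [eLpNorm_norm]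
    gcongr
    refine (eLpNorm_add_le h4 (hw.1.norm.const_mul 2) (by norm_num)).trans ?_
    rw [eLpNorm_norm]
    gcongr
    have := eLpNorm_const_smul_le (c := (2 : ℝ)) (f := fun x => ‖w x‖) (p := 2) (μ := μ)
    refine this.trans (le_of_eq ?_)
    rw [eLpNorm_norm]
    congr 1
    simp [enorm_eq_nnnorm]
  refine tendsto_of_tendsto_of_tendsto_of_le_of_le tendsto_const_nhds ?_ (fun _ => bot_le) hb
  have h2 : Tendsto (fun j => eLpNorm (v j - w) 2 μ + 2 * eLpNorm w 2 μ) atTop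
      (𝓝 (0 + 2 * eLpNorm w 2 μ)) := h.add tendsto_const_nhds
  have h3 := ENNReal.Tendsto.mul h (Or.inr (by
    simpa using ENNReal.mul_ne_top ENNReal.ofNat_ne_top hw.2.ne)) h2 (Or.inr ENNReal.zero_ne_top)
  simpa using h3

lemma gradVec_sub {g h : Space n → ℂ} (hg : ContDiff ℝ ∞ g) (hh : ContDiff ℝ ∞ h) :
    gradVec (g - h) = gradVec g - gradVec h := by
  ext1 x
  rw [Pi.sub_apply, gradVec_eq_gradOf, gradVec_eq_gradOf, gradVec_eq_gradOf, ← map_sub]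
  rw [fderiv_sub (hg.differentiable (by simp) x) (hh.differentiable (by simp) x)]

lemma memLp_gradVec {g : Space n → ℂ} (hg : ContDiff ℝ ∞ g) (hs : HasCompactSupport g) :
    MemLp (gradVec g) 2 volume :=
  (continuous_gradVec hg).memLp_of_hasCompactSupport (hasCompactSupport_gradVec hs)

lemma memLp_inv_norm_smul (hn : 3 ≤ n) {g : Space n → ℂ} (hg : Continuous g)
    (hs : HasCompactSupport g) : MemLp (fun x => ‖x‖⁻¹ • g x) 2 volume := by
  have hm : AEStronglyMeasurable (fun x => ‖x‖⁻¹ • g x) volume :=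
    ((by fun_prop : Measurable fun x : Space n => ‖x‖⁻¹).smul hg.measurable).aestronglyMeasurable
  rw [memLp_two_iff_integrable_sq_norm hm]
  refine (integrable_norm_sq_div hn hg hs).congr (Eventually.of_forall fun x => ?_)
  simp [mul_pow, div_eq_inv_mul]

lemma hardy_eLpNorm (hn : 3 ≤ n) {g : Space n → ℂ} (hg : ContDiff ℝ ∞ g)
    (hs : HasCompactSupport g) :
    eLpNorm (fun x => ‖x‖⁻¹ • g x) 2 volume ≤
      ENNReal.ofReal (2 / ((n : ℝ) - 2)) * eLpNorm (gradVec g) 2 volume := by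
  have hn' : (3 : ℝ) ≤ n := by exact_mod_cast hn
  have hc : 0 < (n : ℝ) - 2 := by linarith
  rw [eLpNorm_two_eq (memLp_inv_norm_smul hn hg.continuous hs),
    eLpNorm_two_eq (memLp_gradVec hg hs), ← ENNReal.ofReal_mul (by positivity)]
  refine ENNReal.ofReal_le_ofReal ?_
  have h := hardy_testFunction hn hg hs
  have e : ∫ x, ‖‖x‖⁻¹ • g x‖ ^ 2 = ∫ x, ‖g x‖ ^ 2 / ‖x‖ ^ 2 :=
    integral_congr_ae (Eventually.of_forall fun x => by
      simp [mul_pow, div_eq_inv_mul])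
  rw [e]
  refine Real.sqrt_le_iff.2 ⟨by positivity, ?_⟩
  rw [mul_pow, Real.sq_sqrt (integral_nonneg fun _ => sq_nonneg _)]
  refine le_trans (le_of_eq ?_) (mul_le_mul_of_nonneg_left h (sq_nonneg _))
  field_simp

/-- `g` is a sequence of test functions that converges to `f` almost everywhere, with gradients
converging to `G` in `L²`. -/
structure Approximates (g : ℕ → Space n → ℂ) (f : Space n → ℂ)
    (G : Space n → EuclideanSpace ℂ (Fin n)) : Prop where
  contDiff : ∀ j, ContDiff ℝ ∞ (g j)
  hasCompactSupport : ∀ j, HasCompactSupport (g j)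
  memLp_grad : MemLp G 2 volume
  tendsto_grad : Tendsto (fun j => eLpNorm (gradVec (g j) - G) 2 volume) atTop (𝓝 0)
  tendsto_ae : ∀ᵐ x, Tendsto (fun j => g j x) atTop (𝓝 (f x))

namespace Approximates

variable {g : ℕ → Space n → ℂ} {f : Space n → ℂ} {G : Space n → EuclideanSpace ℂ (Fin n)}

/-- Hardy's inequality is applied to the test function `g j - g k`; then `k → ∞` by Fatou, since
only almost everywhere convergence to `f` is known. -/
lemma tendsto_div_norm (hn : 3 ≤ n) (h : Approximates g f G) :
    Tendsto (fun j => eLpNorm ((fun x => ‖x‖⁻¹ • g j x) - fun x => ‖x‖⁻¹ • f x) 2 volume)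
      atTop (𝓝 0) := by
  set C := ENNReal.ofReal (2 / ((n : ℝ) - 2))
  have hb : ∀ j, eLpNorm ((fun x => ‖x‖⁻¹ • g j x) - fun x => ‖x‖⁻¹ • f x) 2 volume ≤
      C * eLpNorm (gradVec (g j) - G) 2 volume := by
    intro j
    have h1 := Lp.eLpNorm_lim_le_liminf_eLpNorm (μ := (volume : Measure (Space n))) (p := 2)
      (f := fun k x => ‖x‖⁻¹ • (g j - g k) x)
      (fun k => ((by fun_prop : Measurable fun x : Space n => ‖x‖⁻¹).smul
        ((h.contDiff j).sub (h.contDiff k)).continuous.measurable).aestronglyMeasurable)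
      ((fun x => ‖x‖⁻¹ • g j x) - fun x => ‖x‖⁻¹ • f x) (by
        filter_upwards [h.tendsto_ae] with x hx
        simp only [Pi.sub_apply, smul_sub]
        exact tendsto_const_nhds.sub (hx.const_smul _))
    refine h1.trans ?_
    have h2 : ∀ k, eLpNorm (fun x => ‖x‖⁻¹ • (g j - g k) x) 2 volume ≤
        C * (eLpNorm (gradVec (g j) - G) 2 volume + eLpNorm (gradVec (g k) - G) 2 volume) := by
      intro k
      refine (hardy_eLpNorm hn ((h.contDiff j).sub (h.contDiff k))
        ((h.hasCompactSupport j).sub (h.hasCompactSupport k))).trans ?_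
      refine mul_le_mul_of_nonneg_left ?_ bot_le
      change eLpNorm (gradVec (g j - g k)) 2 volume ≤ _
      rw [gradVec_sub (h.contDiff j) (h.contDiff k)]
      have e : gradVec (g j) - gradVec (g k) = (gradVec (g j) - G) - (gradVec (g k) - G) := by
        abel
      rw [e]
      exact eLpNorm_sub_le
        ((memLp_gradVec (h.contDiff j) (h.hasCompactSupport j)).sub h.memLp_grad).1
        ((memLp_gradVec (h.contDiff k) (h.hasCompactSupport k)).sub h.memLp_grad).1 (by norm_num)
    refine (liminf_le_liminf (Eventually.of_forall h2)).trans (le_of_eq ?_)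
    refine Tendsto.liminf_eq ?_
    have h3 : Tendsto (fun k => eLpNorm (gradVec (g j) - G) 2 volume +
        eLpNorm (gradVec (g k) - G) 2 volume) atTop
        (𝓝 (eLpNorm (gradVec (g j) - G) 2 volume + 0)) :=
      tendsto_const_nhds.add h.tendsto_grad
    rw [add_zero] at h3
    exact ENNReal.Tendsto.const_mul h3 (Or.inr ENNReal.ofReal_ne_top)
  refine tendsto_of_tendsto_of_tendsto_of_le_of_le tendsto_const_nhds ?_ (fun _ => bot_le) hb
  have := ENNReal.Tendsto.const_mul h.tendsto_grad (Or.inr (ENNReal.ofReal_ne_top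
    (r := 2 / ((n : ℝ) - 2))))
  rwa [mul_zero] at this

lemma aestronglyMeasurable (h : Approximates g f G) : AEStronglyMeasurable f volume :=
  aestronglyMeasurable_of_tendsto_ae atTop
    (fun j => (h.contDiff j).continuous.aestronglyMeasurable) h.tendsto_ae

lemma memLp_div_norm (hn : 3 ≤ n) (h : Approximates g f G) :
    MemLp (fun x => ‖x‖⁻¹ • f x) 2 volume := by
  obtain ⟨j, hj⟩ := ((h.tendsto_div_norm hn).eventually (gt_mem_nhds one_pos)).exists
  have h1 : AEStronglyMeasurable (fun x => ‖x‖⁻¹ • f x) volume :=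
    (by fun_prop : Measurable fun x : Space n => ‖x‖⁻¹).aestronglyMeasurable.smul
      h.aestronglyMeasurable
  have h2 := memLp_inv_norm_smul hn (h.contDiff j).continuous (h.hasCompactSupport j)
  have h3 : MemLp ((fun x => ‖x‖⁻¹ • g j x) - fun x => ‖x‖⁻¹ • f x) 2 volume :=
    ⟨h2.1.sub h1, hj.trans ENNReal.one_lt_top⟩
  simpa using h2.sub h3

/-- Factors the singular density into a weight bounded by `|u|` and the square of `|x|⁻¹ f`, the
quantity controlled by Hardy's inequality. -/
lemma dipoleDensity_eq (u : Space n) (f : Space n → ℂ) (x : Space n) :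
    dipoleDensity u f x = inner ℝ u x / ‖x‖ * ‖‖x‖⁻¹ • f x‖ ^ 2 := by
  simp only [dipoleDensity, norm_smul, norm_inv, norm_norm]
  rcases eq_or_ne x 0 with rfl | hx
  · simp
  · have := norm_ne_zero_iff.2 hx
    field_simp

lemma dipole (hn : 3 ≤ n) (h : Approximates g f G) {u : Space n} (hu : ‖u‖ = 1) :
    Integrable (dipoleDensity u f) ∧
      Tendsto (fun j => ∫ x, dipoleDensity u (g j) x) atTop (𝓝 (∫ x, dipoleDensity u f x)) := by
  have h1 := tendsto_integral_mul_norm_sq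
    (fun j => memLp_inv_norm_smul hn (h.contDiff j).continuous (h.hasCompactSupport j))
    (h.memLp_div_norm hn) (h.tendsto_div_norm hn) (a := fun x => inner ℝ u x / ‖x‖)
    (by fun_prop : Measurable fun x : Space n => inner ℝ u x / ‖x‖).aestronglyMeasurable
    (fun x => by
      have := abs_real_inner_le_norm u x
      rw [hu, one_mul] at this
      rw [abs_div, abs_norm]
      exact div_le_one_of_le₀ this (norm_nonneg x))
  simp only [← dipoleDensity_eq] at h1
  refine ⟨(h1.1 _ (h.memLp_div_norm hn)).congr (Eventually.of_forall fun x =>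
    (dipoleDensity_eq u f x).symm), h1.2⟩

lemma tendsto_integral_grad (h : Approximates g f G) :
    Tendsto (fun j => ∫ x, ‖gradVec (g j) x‖ ^ 2) atTop (𝓝 (∫ x, ‖G x‖ ^ 2)) := by
  simpa using (tendsto_integral_mul_norm_sq (a := fun _ => (1 : ℝ))
    (fun j => memLp_gradVec (h.contDiff j) (h.hasCompactSupport j)) h.memLp_grad h.tendsto_grad
    aestronglyMeasurable_const (by simp)).2

lemma tendsto_form (hn : 3 ≤ n) (h : Approximates g f G) {u : Space n} (hu : ‖u‖ = 1) (γ : ℝ) :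
    Tendsto (fun j => (∫ x, ‖gradVec (g j) x‖ ^ 2) + γ * ∫ x, dipoleDensity u (g j) x) atTop
      (𝓝 ((∫ x, ‖G x‖ ^ 2) + γ * ∫ x, dipoleDensity u f x)) :=
  h.tendsto_integral_grad.add ((h.dipole hn hu).2.const_mul γ)

lemma form_nonneg (hn : 3 ≤ n) (h : Approximates g f G) {u : Space n} (hu : ‖u‖ = 1) {γ : ℝ}
    (hγ : -(((n : ℝ) - 2) / 2) ^ 2 ≤ lowestEigenvalue u γ) :
    0 ≤ (∫ x, ‖G x‖ ^ 2) + γ * ∫ x, dipoleDensity u f x :=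
  ge_of_tendsto' (h.tendsto_form hn hu γ) fun j =>
    (integral_nonneg fun x => by positivity).trans
      (dipole_testFunction hn hu hγ (h.contDiff j) (h.hasCompactSupport j))

/-- Vanishing of the form forces a square integrable function to vanish. -/
lemma eq_zero_of_form_eq_zero (hn : 3 ≤ n) (h : Approximates g f G) (hf : MemLp f 2 volume)
    (hL : Tendsto (fun j => eLpNorm (g j - f) 2 volume) atTop (𝓝 0))
    {u : Space n} (hu : ‖u‖ = 1) {γ : ℝ}
    (hγ : -(((n : ℝ) - 2) / 2) ^ 2 ≤ lowestEigenvalue u γ)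
    (h0 : (∫ x, ‖G x‖ ^ 2) + γ * ∫ x, dipoleDensity u f x = 0) : f =ᵐ[volume] 0 := by
  have hg2 : ∀ j, MemLp (g j) 2 volume := fun j =>
    (h.contDiff j).continuous.memLp_of_hasCompactSupport (h.hasCompactSupport j)
  have hw : Continuous fun x : Space n => 1 / (1 + ‖x‖ ^ 2) ^ 2 :=
    continuous_const.div (by fun_prop) fun x => by positivity
  have hw1 : ∀ x : Space n, |1 / (1 + ‖x‖ ^ 2) ^ 2| ≤ 1 := fun x => by
    rw [abs_of_nonneg (by positivity)]
    refine (div_le_one (by positivity)).2 (one_le_pow₀ ?_)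
    linarith [sq_nonneg ‖x‖]
  obtain ⟨i1, t1⟩ := tendsto_integral_mul_norm_sq hg2 hf hL hw.aestronglyMeasurable hw1
  have t2 := (tendsto_integral_mul_norm_sq (a := fun _ => (1 : ℝ)) hg2 hf hL
    aestronglyMeasurable_const (by simp)).2
  simp only [one_mul] at t2
  have t3 := h.tendsto_form hn hu γ
  rw [h0] at t3
  -- The remainder for `g j` is at most the form, which tends to `0`. For fixed `δ` the term with
  -- `δ⁻¹` thus disappears in the limit, leaving `δ ‖f‖²`.
  have hle : ∀ δ : ℝ, 0 < δ → 2 * ∫ x, 1 / (1 + ‖x‖ ^ 2) ^ 2 * ‖f x‖ ^ 2 ≤ δ * ∫ x, ‖f x‖ ^ 2 := by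
    intro δ hδ
    have t4 := (t2.const_mul δ).add (t3.const_mul δ⁻¹)
    rw [mul_zero, add_zero] at t4
    refine le_of_tendsto_of_tendsto' (t1.const_mul 2) t4 fun j => ?_
    have e1 := weighted_norm_le hn (h.contDiff j) (h.hasCompactSupport j) hδ
    have e2 := dipole_testFunction hn hu hγ (h.contDiff j) (h.hasCompactSupport j)
    have e3 := mul_le_mul_of_nonneg_left e2 (inv_nonneg.2 hδ.le)
    have e4 : 2 * ∫ x, 1 / (1 + ‖x‖ ^ 2) ^ 2 * ‖g j x‖ ^ 2 =
        ∫ x, 2 / (1 + ‖x‖ ^ 2) ^ 2 * ‖g j x‖ ^ 2 := by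
      rw [← integral_const_mul]
      exact integral_congr_ae (Eventually.of_forall fun x => by simp only; ring)
    rw [e4]
    exact e1.trans (add_le_add_right e3 _)
  have hz : ∫ x, 1 / (1 + ‖x‖ ^ 2) ^ 2 * ‖f x‖ ^ 2 ≤ 0 := by
    set A := ∫ x, 1 / (1 + ‖x‖ ^ 2) ^ 2 * ‖f x‖ ^ 2
    set B := ∫ x, ‖f x‖ ^ 2
    have hB : 0 ≤ B := integral_nonneg fun _ => sq_nonneg _
    by_contra hA
    push Not at hA
    -- With this `δ` the bound reads `2A ≤ AB/(B+1)`, impossible for `A > 0`; the `+ 1` avoids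
    -- dividing by zero.
    have h1 := hle (A / (B + 1)) (div_pos hA (by linarith))
    rw [div_mul_eq_mul_div, le_div_iff₀ (by linarith)] at h1
    nlinarith
  have hz' := le_antisymm hz (integral_nonneg fun x => by positivity)
  rw [integral_eq_zero_iff_of_nonneg (fun x => by positivity) (i1 f hf)] at hz'
  filter_upwards [hz'] with x hx
  have : (1 + ‖x‖ ^ 2) ^ 2 ≠ 0 := by positivity
  simpa [this] using hx

end Approximates

/-- Convergence in the Sobolev exponent implies convergence in measure, hence almost everywhere
along a subsequence. -/
lemma MemD1.exists_approximates {f : Space n → ℂ} {G : Space n → EuclideanSpace ℂ (Fin n)}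
    (hn : 3 ≤ n) (h : MemD1 f G) : ∃ g, Approximates g f G := by
  obtain ⟨g, hg, h1, h2⟩ := h.approx
  have hn' : (3 : ℝ) ≤ n := by exact_mod_cast hn
  have hp : ENNReal.ofReal (2 * n / (n - 2)) ≠ 0 := by
    rw [ne_eq, ENNReal.ofReal_eq_zero, not_le]
    exact div_pos (by linarith) (by linarith)
  obtain ⟨φ, hφ, hae⟩ := (tendstoInMeasure_of_tendsto_eLpNorm hp
    (fun j => (hg j).1.continuous.aestronglyMeasurable) h.memLp.1 h2).exists_seq_tendsto_ae
  exact ⟨fun j => g (φ j), fun j => (hg _).1, fun j => (hg _).2, h.memLp_grad,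
    h1.comp hφ.tendsto_atTop, hae⟩

end Limits

/-! ### Density of test functions in `H¹` -/

section Density

variable {n : ℕ}

lemma tendsto_eLpNorm_zero_of_dominated {α V : Type*} [MeasurableSpace α] {μ : Measure α}
    [NormedAddCommGroup V] {v : ℕ → α → V} {b : α → ℝ}
    (hv : ∀ j, AEStronglyMeasurable (v j) μ) (hb : MemLp b 2 μ) (hle : ∀ j x, ‖v j x‖ ≤ b x)
    (hlim : ∀ x, Tendsto (fun j => v j x) atTop (𝓝 0)) :
    Tendsto (fun j => eLpNorm (v j) 2 μ) atTop (𝓝 0) := by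
  have hm : ∀ j, MemLp (v j) 2 μ := fun j => hb.of_le (hv j) (Eventually.of_forall fun x =>
    (hle j x).trans (le_abs_self _))
  have h1 : Tendsto (fun j => ∫ x, ‖v j x‖ ^ 2 ∂μ) atTop (𝓝 (∫ x, (0 : ℝ) ∂μ)) := by
    refine tendsto_integral_of_dominated_convergence (fun x => ‖b x‖ ^ 2)
      (fun j => (hv j).norm.pow 2) (hb.integrable_norm_pow two_ne_zero)
      (fun j => Eventually.of_forall fun x => ?_) (Eventually.of_forall fun x => ?_)
    · rw [Real.norm_eq_abs, abs_of_nonneg (sq_nonneg _)]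
      gcongr
      exact (hle j x).trans (le_abs_self _)
    · simpa using ((hlim x).norm.pow 2)
  rw [integral_zero] at h1
  simp_rw [eLpNorm_two_eq (hm _)]
  have h2 := ENNReal.tendsto_ofReal ((Real.continuous_sqrt.tendsto 0).comp h1)
  simpa using h2

/-- Translations act continuously on `L²`; this is continuity at `t = 0`. -/
lemma exists_eLpNorm_translation_le {V : Type*} [NormedAddCommGroup V] {K : Space n → V}
    (hK : MemLp K 2 volume) {ε : ℝ≥0∞} (hε : 0 < ε) :
    ∃ r : ℝ, 0 < r ∧ ∀ t : Space n, ‖t‖ < r →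
      eLpNorm (fun x => K (x - t) - K x) 2 volume ≤ ε := by
  let τ : C(Space n, C(Space n, Space n)) :=
    (ContinuousMap.mk (fun p : Space n × Space n => p.2 - p.1) (by fun_prop)).curry
  have hτ : ∀ t, MeasurePreserving (τ t) volume volume :=
    fun t => measurePreserving_sub_right volume t
  have hc : Continuous fun t => Lp.compMeasurePreserving (τ t) (hτ t) (hK.toLp K) :=
    Continuous.compMeasurePreservingLp (f := fun _ : Space n => hK.toLp K) continuous_const
      τ.continuous hτ (by simp)
  have h0 : Lp.compMeasurePreserving (τ 0) (hτ 0) (hK.toLp K) = hK.toLp K := by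
    rw [Lp.toLp_compMeasurePreserving]
    congr 1
    ext x
    simp [τ]
  have h1 := (EMetric.tendsto_nhds.1 (hc.tendsto 0)) ε hε
  rw [Metric.eventually_nhds_iff] at h1
  obtain ⟨r, hr, h⟩ := h1
  refine ⟨r, hr, fun t ht => ?_⟩
  have h2 := h (y := t) (by simpa using ht)
  rw [h0, Lp.toLp_compMeasurePreserving, Lp.edist_toLp_toLp] at h2
  exact h2.le

/-- Jensen's inequality for the probability density `p`, obtained from Hölder against the constant
`1`. -/
lemma sq_lintegral_mul_le {α : Type*} [MeasurableSpace α] {μ : Measure α} {p h : α → ℝ≥0∞}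
    (hp : Measurable p) (hh : Measurable h) (h1 : ∫⁻ t, p t ∂μ = 1) :
    (∫⁻ t, p t * h t ∂μ) ^ 2 ≤ ∫⁻ t, p t * h t ^ 2 ∂μ := by
  have e : ∀ k : α → ℝ≥0∞, Measurable k → ∫⁻ t, p t * k t ∂μ = ∫⁻ t, k t ∂(μ.withDensity p) :=
    fun k hk => (lintegral_withDensity_eq_lintegral_mul μ hp hk).symm
  rw [e h hh, e (fun t => h t ^ 2) (by fun_prop)]
  have := ENNReal.lintegral_mul_le_Lp_mul_Lq (μ.withDensity p) Real.HolderConjugate.two_two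
    hh.aemeasurable (aemeasurable_const (b := (1 : ℝ≥0∞)))
  simp only [Pi.mul_apply, mul_one, ENNReal.one_rpow, lintegral_const,
    withDensity_apply _ MeasurableSet.univ, Measure.restrict_univ, h1] at this
  calc (∫⁻ t, h t ∂(μ.withDensity p)) ^ 2
      ≤ ((∫⁻ t, h t ^ (2 : ℝ) ∂(μ.withDensity p)) ^ (1 / 2 : ℝ)) ^ 2 := by gcongr
    _ = _ := by
      rw [← ENNReal.rpow_natCast, ← ENNReal.rpow_mul]
      norm_num

/-- A mollifier supported in the ball of radius `r`. -/
structure IsMollifier (φ : Space n → ℝ) (r : ℝ) : Prop where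
  contDiff : ContDiff ℝ ∞ φ
  hasCompactSupport : HasCompactSupport φ
  nonneg : ∀ x, 0 ≤ φ x
  integral_eq_one : ∫ x, φ x = 1
  support : ∀ x, r ≤ ‖x‖ → φ x = 0

lemma exists_isMollifier {r : ℝ} (hr : 0 < r) : ∃ φ : Space n → ℝ, IsMollifier φ r := by
  let B : ContDiffBump (0 : Space n) := ⟨r / 2, r, by positivity, by linarith⟩
  refine ⟨B.normed volume, B.contDiff_normed, B.hasCompactSupport_normed, B.nonneg_normed,
    B.integral_normed, fun x hx => ?_⟩
  have : x ∉ Function.support (B.normed (volume : Measure (Space n))) := by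
    rw [B.support_normed_eq]
    simpa [B] using hx
  simpa using this

/-- The convolution of a vector valued function with a scalar kernel. -/
def mollify {V : Type*} [NormedAddCommGroup V] [NormedSpace ℝ V] (φ : Space n → ℝ)
    (K : Space n → V) (x : Space n) : V := ∫ t, φ t • K (x - t)

lemma mollify_eq_convolution {V : Type*} [NormedAddCommGroup V] [NormedSpace ℝ V] (φ : Space n → ℝ)
    (K : Space n → V) :
    mollify φ K = convolution φ K (ContinuousLinearMap.lsmul ℝ ℝ) volume := rfl

section Mollify

variable {V : Type*} [NormedAddCommGroup V] [NormedSpace ℝ V]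
  {φ : Space n → ℝ} {r : ℝ} {K : Space n → V}

lemma IsMollifier.integrable (hφ : IsMollifier φ r) (hK : LocallyIntegrable K volume)
    (x : Space n) : Integrable fun t => φ t • K (x - t) :=
  (hφ.hasCompactSupport.convolutionExists_left (ContinuousLinearMap.lsmul ℝ ℝ)
    hφ.contDiff.continuous hK x)

lemma contDiff_mollify (hφ : IsMollifier φ r) (hK : LocallyIntegrable K volume) :
    ContDiff ℝ ∞ (mollify φ K) :=
  hφ.hasCompactSupport.contDiff_convolution_left (ContinuousLinearMap.lsmul ℝ ℝ) hφ.contDiff hK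

/-- The difference is an average of translation errors `K(x-t) - K(x)` over `|t| < r`. Jensen moves
the square inside and Tonelli exchanges the integrals; strong measurability of `K` is what Tonelli
needs. -/
lemma eLpNorm_mollify_sub_le [CompleteSpace V] (hφ : IsMollifier φ r) (hKm : StronglyMeasurable K)
    (hK : MemLp K 2 volume) {ε : ℝ≥0∞} (hε : ∀ t : Space n, ‖t‖ < r →
      eLpNorm (fun x => K (x - t) - K x) 2 volume ≤ ε) :
    eLpNorm (mollify φ K - K) 2 volume ≤ ε := by
  have hloc : LocallyIntegrable K volume := hK.locallyIntegrable (by norm_num)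
  have hφi : Integrable φ :=
    hφ.contDiff.continuous.integrable_of_hasCompactSupport hφ.hasCompactSupport
  have hφ1 : ∫⁻ t, ‖φ t‖ₑ = 1 := by
    have h := ofReal_integral_eq_lintegral_ofReal hφi (Eventually.of_forall hφ.nonneg)
    rw [hφ.integral_eq_one, ENNReal.ofReal_one] at h
    rw [h]
    refine lintegral_congr fun t => ?_
    rw [Real.enorm_eq_ofReal (hφ.nonneg t)]
  have hφm : Measurable fun t => ‖φ t‖ₑ := hφ.contDiff.continuous.measurable.enorm
  have hm2 : StronglyMeasurable fun p : Space n × Space n => K (p.1 - p.2) - K p.1 :=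
    (hKm.comp_measurable (measurable_fst.sub measurable_snd)).sub
      (hKm.comp_measurable measurable_fst)
  have hpt : ∀ x, ‖(mollify φ K - K) x‖ₑ ^ 2 ≤ ∫⁻ t, ‖φ t‖ₑ * ‖K (x - t) - K x‖ₑ ^ 2 := by
    intro x
    have e : (mollify φ K - K) x = ∫ t, φ t • (K (x - t) - K x) := by
      simp only [smul_sub]
      rw [integral_sub (hφ.integrable hloc x) (hφi.smul_const _), integral_smul_const,
        hφ.integral_eq_one, one_smul]
      rfl
    rw [e]
    refine le_trans ?_ (sq_lintegral_mul_le hφm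
      (hm2.comp_measurable (measurable_const.prodMk measurable_id)).enorm hφ1)
    gcongr
    refine (enorm_integral_le_lintegral_enorm _).trans (le_of_eq ?_)
    simp only [enorm_smul]
  have hsq : ∀ u : Space n → V, eLpNorm u 2 volume ^ 2 = ∫⁻ x, ‖u x‖ₑ ^ 2 := by
    intro u
    rw [eLpNorm_eq_lintegral_rpow_enorm_toReal (by norm_num) (by norm_num),
      ← ENNReal.rpow_natCast, ← ENNReal.rpow_mul]
    simp
  have h2 : eLpNorm (mollify φ K - K) 2 volume ^ 2 ≤ ε ^ 2 := by
    rw [hsq]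
    calc ∫⁻ x, ‖(mollify φ K - K) x‖ₑ ^ 2
        ≤ ∫⁻ x, ∫⁻ t, ‖φ t‖ₑ * ‖K (x - t) - K x‖ₑ ^ 2 := lintegral_mono hpt
      _ = ∫⁻ t, ∫⁻ x, ‖φ t‖ₑ * ‖K (x - t) - K x‖ₑ ^ 2 := by
        refine lintegral_lintegral_swap (Measurable.aemeasurable ?_)
        exact (hφm.comp measurable_snd).mul (hm2.enorm.pow_const 2)
      _ = ∫⁻ t, ‖φ t‖ₑ * eLpNorm (fun x => K (x - t) - K x) 2 volume ^ 2 := by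
        refine lintegral_congr fun t => ?_
        rw [hsq, lintegral_const_mul]
        exact (hm2.comp_measurable (measurable_id.prodMk measurable_const)).enorm.pow_const 2
      _ ≤ ∫⁻ t, ‖φ t‖ₑ * ε ^ 2 := by
        refine lintegral_mono fun t => ?_
        by_cases ht : ‖t‖ < r
        · gcongr
          exact hε t ht
        · simp [hφ.support t (not_lt.1 ht)]
      _ = ε ^ 2 := by rw [lintegral_mul_const _ hφm, hφ1, one_mul]
  exact (ENNReal.pow_right_strictMono two_ne_zero).le_iff_le.1 h2

end Mollify

/-- The definition of the weak gradient is tested on `s ↦ φ(x - s)`; the sign from the inner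
derivative cancels the one from the integration by parts. -/
lemma gradVec_mollify {φ : Space n → ℝ} {r : ℝ} (hφ : IsMollifier φ r) {f : Space n → ℂ}
    {G : Space n → EuclideanSpace ℂ (Fin n)} (h : MemH1 f G) :
    gradVec (mollify φ f) = mollify φ G := by
  have hf : LocallyIntegrable f volume := h.memLp.locallyIntegrable (by norm_num)
  have hG : LocallyIntegrable G volume := h.memLp_grad.locallyIntegrable (by norm_num)
  ext x i
  have h1 := (hφ.hasCompactSupport.hasFDerivAt_convolution_left (ContinuousLinearMap.lsmul ℝ ℝ)
    (hφ.contDiff.of_le (by simp)) hf x).fderiv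
  have hi : Integrable fun t => (((ContinuousLinearMap.lsmul ℝ ℝ).precompL (Space n))
      (fderiv ℝ φ t)) (f (x - t)) :=
    (hφ.hasCompactSupport.fderiv (𝕜 := ℝ)).convolutionExists_left _
      (hφ.contDiff.continuous_fderiv (by simp)) hf x
  have h2 : gradVec (mollify φ f) x i =
      ∫ t, fderiv ℝ φ t (EuclideanSpace.single i 1) • f (x - t) := by
    change fderiv ℝ (mollify φ f) x (EuclideanSpace.single i 1) = _
    rw [mollify_eq_convolution, h1, convolution, ContinuousLinearMap.integral_apply hi]
    rfl
  have h3 : mollify φ G x i = ∫ t, φ t • G (x - t) i := by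
    have := (EuclideanSpace.proj (𝕜 := ℂ) i).integral_comp_comm (hφ.integrable hG x)
    simp only [PiLp.proj_apply] at this
    exact this.symm
  rw [h2, h3, ← integral_sub_left_eq_self (fun t => fderiv ℝ φ t (EuclideanSpace.single i 1) •
    f (x - t)) volume x, ← integral_sub_left_eq_self (fun t => φ t • G (x - t) i) volume x]
  have hψs : HasCompactSupport fun s => φ (x - s) :=
    hφ.hasCompactSupport.comp_homeomorph (Homeomorph.subLeft x)
  have hψd : ContDiff ℝ ∞ fun s => φ (x - s) :=
    hφ.contDiff.comp (contDiff_const.sub contDiff_id)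
  have h4 := h.weak_grad (fun s => φ (x - s)) hψd hψs i
  have h5 : ∀ s, partialDeriv (fun s => φ (x - s)) i s =
      -fderiv ℝ φ (x - s) (EuclideanSpace.single i 1) := by
    intro s
    unfold partialDeriv
    have := ((hφ.contDiff.differentiable (by simp) (x - s)).hasFDerivAt.comp s
      ((hasFDerivAt_id s).const_sub x)).fderiv
    simp only [Function.comp_def] at this
    rw [this]
    simp
  simp only [h5, neg_smul, integral_neg, neg_inj] at h4
  simpa using h4

/-- Smooth cutoff functions exhausting the space, with uniformly bounded gradients. -/
lemma exists_cutoff (n : ℕ) : ∃ (χ : ℕ → Space n → ℝ) (C : ℝ), (∀ k, ContDiff ℝ ∞ (χ k)) ∧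
    (∀ k, HasCompactSupport (χ k)) ∧ (∀ k x, |χ k x - 1| ≤ 1) ∧
    (∀ k x, ‖fderiv ℝ (χ k) x‖ ≤ C) ∧ ∀ x, ∀ᶠ k in atTop, χ k =ᶠ[𝓝 x] 1 := by
  let B : ContDiffBump (0 : Space n) := ⟨1, 2, one_pos, one_lt_two⟩
  have hpos : ∀ k : ℕ, (0 : ℝ) < (k : ℝ) + 1 := fun k => by positivity
  have hBd : ContDiff ℝ 1 B := B.contDiff
  obtain ⟨C, hC⟩ := (hBd.continuous_fderiv one_ne_zero).bounded_above_of_compact_support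
    (B.hasCompactSupport.fderiv (𝕜 := ℝ))
  refine ⟨fun k x => B (((k : ℝ) + 1)⁻¹ • x), C, fun k => B.contDiff.comp (contDiff_const_smul _),
    fun k => B.hasCompactSupport.comp_homeomorph
      (Homeomorph.smulOfNeZero _ (inv_ne_zero (hpos k).ne')),
    fun k x => abs_le.2 ⟨?_, ?_⟩, fun k x => ?_, fun x => ?_⟩
  · linarith [B.nonneg (x := ((k : ℝ) + 1)⁻¹ • x)]
  · linarith [B.le_one (x := ((k : ℝ) + 1)⁻¹ • x)]
  · have e : fderiv ℝ (fun x => B (((k : ℝ) + 1)⁻¹ • x)) x =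
        ((k : ℝ) + 1)⁻¹ • fderiv ℝ B (((k : ℝ) + 1)⁻¹ • x) := fderiv_comp_smul _
    rw [e, norm_smul, norm_inv, Real.norm_eq_abs, abs_of_pos (hpos k)]
    exact (mul_le_of_le_one_left (norm_nonneg _) (inv_le_one_of_one_le₀ (by
      have : (0 : ℝ) ≤ k := k.cast_nonneg
      linarith))).trans (hC _)
  · obtain ⟨k₀, hk₀⟩ := exists_nat_gt ‖x‖
    filter_upwards [eventually_ge_atTop k₀] with k hk
    have hkx : ‖x‖ < (k : ℝ) + 1 := by
      have : (k₀ : ℝ) ≤ k := by exact_mod_cast hk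
      linarith
    filter_upwards [continuous_norm.continuousAt.eventually_lt_const hkx] with z hz
    refine B.one_of_mem_closedBall ?_
    rw [mem_closedBall_zero_iff, norm_smul, norm_inv, Real.norm_eq_abs,
      abs_of_pos (hpos k), inv_mul_le_iff₀ (hpos k)]
    simpa [B] using hz.le

/-- By the product rule `∇(χh) - ∇h = (χ-1)∇h + h∇χ`. Both terms are dominated in `L²` uniformly in
the cutoff and eventually vanish at each point. -/
lemma exists_truncation {h : Space n → ℂ} (hd : ContDiff ℝ ∞ h) (hm : MemLp h 2 volume)
    (hg : MemLp (gradVec h) 2 volume) {ε : ℝ≥0∞} (hε : 0 < ε) :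
    ∃ g : Space n → ℂ, ContDiff ℝ ∞ g ∧ HasCompactSupport g ∧
      eLpNorm (g - h) 2 volume ≤ ε ∧ eLpNorm (gradVec g - gradVec h) 2 volume ≤ ε := by
  obtain ⟨χ, C, hχd, hχs, hχ1, hχf, hev⟩ := exists_cutoff n
  let g : ℕ → Space n → ℂ := fun k x => χ k x • h x
  have hgd : ∀ k, ContDiff ℝ ∞ (g k) := fun k => (hχd k).smul hd
  have hgs : ∀ k, HasCompactSupport (g k) := fun k => (hχs k).smul_right
  have hgev : ∀ x, ∀ᶠ k in atTop, g k =ᶠ[𝓝 x] h := by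
    intro x
    filter_upwards [hev x] with k hk
    filter_upwards [hk] with z hz
    simp [g, hz]
  have t1 : Tendsto (fun k => eLpNorm (g k - h) 2 volume) atTop (𝓝 0) := by
    refine tendsto_eLpNorm_zero_of_dominated
      (fun k => ((hgd k).continuous.sub hd.continuous).aestronglyMeasurable) hm.norm
      (fun k x => ?_) (fun x => ?_)
    · have e : (g k - h) x = (χ k x - 1) • h x := by simp [g, sub_mul]
      rw [e, norm_smul, Real.norm_eq_abs]
      exact mul_le_of_le_one_left (norm_nonneg _) (hχ1 k x)
    · refine tendsto_const_nhds.congr' ?_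
      filter_upwards [hgev x] with k hk
      simp [hk.eq_of_nhds]
  have t2 : Tendsto (fun k => eLpNorm (gradVec (g k) - gradVec h) 2 volume) atTop (𝓝 0) := by
    let M := ‖(gradOf (n := n)).toContinuousLinearMap‖
    refine tendsto_eLpNorm_zero_of_dominated
      (b := fun x => ‖gradVec h x‖ + M * C * ‖h x‖)
      (fun k => ((continuous_gradVec (hgd k)).sub (continuous_gradVec hd)).aestronglyMeasurable)
      (hg.norm.add (hm.norm.const_mul (M * C))) (fun k x => ?_) (fun x => ?_)
    · have e : (gradVec (g k) - gradVec h) x = (χ k x - 1) • gradVec h x +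
          gradOf ((fderiv ℝ (χ k) x).smulRight (h x)) := by
        have hd1 := ((hχd k).differentiable (by simp) x).hasFDerivAt
        have hd2 := (hd.differentiable (by simp) x).hasFDerivAt
        have : fderiv ℝ (g k) x = _ := (hd1.smul hd2).fderiv
        rw [Pi.sub_apply, gradVec_eq_gradOf, gradVec_eq_gradOf, this, map_add, map_smul, sub_smul,
          one_smul]
        abel
      rw [e]
      refine (norm_add_le _ _).trans (add_le_add ?_ ?_)
      · rw [norm_smul, Real.norm_eq_abs]
        exact mul_le_of_le_one_left (norm_nonneg _) (hχ1 k x)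
      · refine ((gradOf (n := n)).toContinuousLinearMap.le_opNorm _).trans ?_
        rw [ContinuousLinearMap.norm_smulRight_apply, mul_assoc]
        gcongr
        exact hχf k x
    · refine tendsto_const_nhds.congr' ?_
      filter_upwards [hgev x] with k hk
      rw [Pi.sub_apply, gradVec_eq_gradOf, gradVec_eq_gradOf, hk.fderiv_eq, sub_self]
  obtain ⟨k, hk1, hk2⟩ := ((t1.eventually (ge_mem_nhds hε)).and
    (t2.eventually (ge_mem_nhds hε))).exists
  exact ⟨g k, hgd k, hgs k, hk1, hk2⟩

/-- Mollification gives smoothness and the cutoff gives compact support, each at cost `ε/2`. A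
finite `ε` ensures that the mollified function and its gradient stay in `L²`. -/
lemma MemH1.exists_testFunction {f : Space n → ℂ} {G : Space n → EuclideanSpace ℂ (Fin n)}
    (h : MemH1 f G) (hfm : StronglyMeasurable f) (hGm : StronglyMeasurable G) {ε : ℝ≥0∞}
    (hε : 0 < ε) :
    ∃ g : Space n → ℂ, ContDiff ℝ ∞ g ∧ HasCompactSupport g ∧
      eLpNorm (g - f) 2 volume ≤ ε ∧ eLpNorm (gradVec g - G) 2 volume ≤ ε := by
  wlog hε' : ε ≠ ⊤ generalizing ε
  · obtain ⟨g, h1, h2, h3, h4⟩ := this one_pos ENNReal.one_ne_top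
    exact ⟨g, h1, h2, h3.trans (by simp_all), h4.trans (by simp_all)⟩
  have hε2 : 0 < ε / 2 := ENNReal.half_pos hε.ne'
  obtain ⟨r₁, hr₁, ht₁⟩ := exists_eLpNorm_translation_le h.memLp hε2
  obtain ⟨r₂, hr₂, ht₂⟩ := exists_eLpNorm_translation_le h.memLp_grad hε2
  obtain ⟨φ, hφ⟩ := exists_isMollifier (n := n) (lt_min hr₁ hr₂)
  have hd := contDiff_mollify hφ (h.memLp.locallyIntegrable (by norm_num))
  have hgr := gradVec_mollify hφ h
  have m1 := eLpNorm_mollify_sub_le hφ hfm h.memLp fun t ht => ht₁ t (ht.trans_le (min_le_left _ _))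
  have m2 := eLpNorm_mollify_sub_le hφ hGm h.memLp_grad fun t ht =>
    ht₂ t (ht.trans_le (min_le_right _ _))
  rw [← hgr] at m2
  have hlt : ε / 2 < ⊤ := (ENNReal.div_lt_top hε' two_ne_zero)
  have l1 : MemLp (mollify φ f - f) 2 volume :=
    ⟨hd.continuous.aestronglyMeasurable.sub h.memLp.1, m1.trans_lt hlt⟩
  have l2 : MemLp (gradVec (mollify φ f) - G) 2 volume :=
    ⟨(continuous_gradVec hd).aestronglyMeasurable.sub h.memLp_grad.1, m2.trans_lt hlt⟩
  have l1' : MemLp (mollify φ f) 2 volume := by simpa using l1.add h.memLp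
  have l2' : MemLp (gradVec (mollify φ f)) 2 volume := by simpa using l2.add h.memLp_grad
  obtain ⟨g, hg1, hg2, hg3, hg4⟩ := exists_truncation hd l1' l2' hε2
  refine ⟨g, hg1, hg2, ?_, ?_⟩
  · have e : g - f = (g - mollify φ f) + (mollify φ f - f) := by abel
    rw [e, ← ENNReal.add_halves ε]
    exact (eLpNorm_add_le (hg1.continuous.sub hd.continuous).aestronglyMeasurable l1.1
      (by norm_num)).trans (add_le_add hg3 m1)
  · have e : gradVec g - G = (gradVec g - gradVec (mollify φ f)) + (gradVec (mollify φ f) - G) := by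
      abel
    rw [e, ← ENNReal.add_halves ε]
    exact (eLpNorm_add_le ((continuous_gradVec hg1).sub
      (continuous_gradVec hd)).aestronglyMeasurable l2.1 (by norm_num)).trans (add_le_add hg4 m2)

lemma MemH1.congr {f f' : Space n → ℂ} {G G' : Space n → EuclideanSpace ℂ (Fin n)}
    (h : MemH1 f G) (hf : f =ᵐ[volume] f') (hG : G =ᵐ[volume] G') : MemH1 f' G' := by
  refine ⟨h.memLp.ae_eq hf, h.memLp_grad.ae_eq hG, fun φ hφ hs i => ?_⟩
  have h1 : ∫ x, partialDeriv φ i x • f' x = ∫ x, partialDeriv φ i x • f x :=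
    integral_congr_ae (by filter_upwards [hf] with x hx; rw [hx])
  have h2 : ∫ x, φ x • G' x i = ∫ x, φ x • G x i :=
    integral_congr_ae (by filter_upwards [hG] with x hx; rw [hx])
  rw [h1, h2]
  exact h.weak_grad φ hφ hs i

/-- Mollification is applied to strongly measurable representatives of `f` and `G`; passing to a
subsequence adds almost everywhere convergence. -/
lemma MemH1.exists_approximates {f : Space n → ℂ} {G : Space n → EuclideanSpace ℂ (Fin n)}
    (h : MemH1 f G) : ∃ g, Approximates g f G ∧
      Tendsto (fun j => eLpNorm (g j - f) 2 volume) atTop (𝓝 0) := by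
  have ef := h.memLp.1.ae_eq_mk
  have eG := h.memLp_grad.1.ae_eq_mk
  have h' := h.congr ef eG
  have hpos : ∀ j : ℕ, (0 : ℝ≥0∞) < ((j : ℝ≥0∞) + 1)⁻¹ := fun j => by simp
  choose g hg1 hg2 hg3 hg4 using fun j : ℕ => h'.exists_testFunction
    h.memLp.1.stronglyMeasurable_mk h.memLp_grad.1.stronglyMeasurable_mk (hpos j)
  have hlim : Tendsto (fun j : ℕ => ((j : ℝ≥0∞) + 1)⁻¹) atTop (𝓝 0) := by
    have := ENNReal.tendsto_inv_nat_nhds_zero.comp (tendsto_add_atTop_nat 1)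
    simpa [Function.comp_def] using this
  have t1 : Tendsto (fun j => eLpNorm (g j - f) 2 volume) atTop (𝓝 0) := by
    refine tendsto_of_tendsto_of_tendsto_of_le_of_le tendsto_const_nhds hlim (fun _ => bot_le)
      fun j => le_trans (le_of_eq ?_) (hg3 j)
    exact eLpNorm_congr_ae ((ae_eq_refl _).sub ef)
  have t2 : Tendsto (fun j => eLpNorm (gradVec (g j) - G) 2 volume) atTop (𝓝 0) := by
    refine tendsto_of_tendsto_of_tendsto_of_le_of_le tendsto_const_nhds hlim (fun _ => bot_le)
      fun j => le_trans (le_of_eq ?_) (hg4 j)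
    exact eLpNorm_congr_ae ((ae_eq_refl _).sub eG)
  obtain ⟨ψ, hψ, hae⟩ := (tendstoInMeasure_of_tendsto_eLpNorm two_ne_zero
    (fun j => (hg1 j).continuous.aestronglyMeasurable) h.memLp.1 t1).exists_seq_tendsto_ae
  exact ⟨fun j => g (ψ j), ⟨fun j => hg1 _, fun j => hg2 _, h.memLp_grad,
    t2.comp hψ.tendsto_atTop, hae⟩, t1.comp hψ.tendsto_atTop⟩

/-- The weak gradient of the zero function vanishes. -/
lemma MemH1.grad_eq_zero {f : Space n → ℂ} {G : Space n → EuclideanSpace ℂ (Fin n)}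
    (h : MemH1 f G) (hf : f =ᵐ[volume] 0) : G =ᵐ[volume] 0 := by
  have hi : ∀ i, ∀ᵐ x, G x i = 0 := by
    intro i
    have hGi : LocallyIntegrable (fun x => G x i) volume :=
      ((EuclideanSpace.proj (𝕜 := ℂ) i).comp_memLp' h.memLp_grad).locallyIntegrable (by norm_num)
    refine ae_eq_zero_of_integral_contDiff_smul_eq_zero hGi fun φ hφ hs => ?_
    have h1 := h.weak_grad φ hφ hs i
    have h2 : ∫ x, partialDeriv φ i x • f x = 0 :=
      integral_eq_zero_of_ae (by filter_upwards [hf] with x hx; simp [hx])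
    rw [h2] at h1
    exact neg_eq_zero.1 h1.symm
  filter_upwards [ae_all_iff.2 hi] with x hx
  ext i
  simpa using hx i

end Density

/-! ### Optimality of the critical constant -/

section Optimality

variable {n : ℕ}

lemma memD1_testFunction {f : Space n → ℂ} (hf : ContDiff ℝ ∞ f) (hs : HasCompactSupport f) :
    MemD1 f (gradVec f) := by
  refine ⟨hf.continuous.memLp_of_hasCompactSupport hs, memLp_gradVec hf hs,
    fun _ => f, fun _ => ⟨hf, hs⟩, ?_, ?_⟩ <;> simp

/-! ### Product trial functions in logarithmic polar coordinates. -/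

/-- The function `ψ(log r) F(ω)`, extended by zero to the origin. -/
def logProduct (ψ : ℝ → ℝ) (F : Space n → ℂ) (x : Space n) : ℂ :=
  if x = 0 then 0 else ((ψ (Real.log ‖x‖) : ℝ) : ℂ) * F x

section LogProduct

variable {ψ : ℝ → ℝ} {F : Space n → ℂ}

lemma exists_eq_zero_of_abs (hs : HasCompactSupport ψ) : ∃ A : ℝ, ∀ t, A < |t| → ψ t = 0 := by
  obtain ⟨A, hA⟩ := hs.isCompact.isBounded.subset_closedBall (0 : ℝ)
  refine ⟨A, fun t ht => image_eq_zero_of_notMem_tsupport fun h => ?_⟩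
  have := mem_closedBall_zero_iff.1 (hA h)
  rw [Real.norm_eq_abs] at this
  linarith

lemma hasCompactSupport_logProduct (hs : HasCompactSupport ψ) :
    HasCompactSupport (logProduct ψ F) := by
  obtain ⟨A, hA⟩ := exists_eq_zero_of_abs hs
  refine HasCompactSupport.intro (isCompact_closedBall (0 : Space n) (Real.exp A)) fun x hx => ?_
  rw [mem_closedBall_zero_iff, not_le] at hx
  have hx0 : x ≠ 0 := norm_pos_iff.1 ((Real.exp_pos A).trans hx)
  rw [logProduct, if_neg hx0, hA]
  · simp
  · exact ((Real.lt_log_iff_exp_lt (norm_pos_iff.2 hx0)).2 hx).trans_le (le_abs_self _)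

lemma logProduct_eventuallyEq {x : Space n} (hx : x ≠ 0) :
    logProduct ψ F =ᶠ[𝓝 x] fun x => ((ψ (Real.log ‖x‖) : ℝ) : ℂ) * F x := by
  filter_upwards [isOpen_compl_singleton.mem_nhds hx] with z hz
  exact if_neg hz

/-- The compact support of `ψ` makes the product vanish near the origin, the only point where `log
|x|` and `F` may fail to be smooth. -/
lemma contDiff_logProduct (hψ : ContDiff ℝ ∞ ψ) (hs : HasCompactSupport ψ)
    (hF : IsSphereSmooth F) : ContDiff ℝ ∞ (logProduct ψ F) := by
  rw [contDiff_iff_contDiffAt]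
  intro x
  rcases eq_or_ne x 0 with rfl | hx
  · obtain ⟨A, hA⟩ := exists_eq_zero_of_abs hs
    have h : logProduct ψ F =ᶠ[𝓝 0] fun _ => 0 := by
      filter_upwards [Metric.ball_mem_nhds (0 : Space n) (Real.exp_pos (-A))] with z hz
      rw [mem_ball_zero_iff] at hz
      rw [logProduct]
      split_ifs with hz0
      · rfl
      rw [hA]
      · simp
      · have := (Real.log_lt_iff_lt_exp (norm_pos_iff.2 hz0)).2 hz
        linarith [neg_abs_le (Real.log ‖z‖)]
    exact contDiffAt_const.congr_of_eventuallyEq h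
  · refine ContDiffAt.congr_of_eventuallyEq ?_ (logProduct_eventuallyEq hx)
    have h1 : ContDiffAt ℝ ∞ (fun x : Space n => Real.log ‖x‖) x :=
      (contDiffAt_norm ℝ hx).log (norm_ne_zero_iff.2 hx)
    have h2 : ContDiffAt ℝ ∞ (fun x : Space n => ψ (Real.log ‖x‖)) x :=
      hψ.contDiffAt.comp x h1
    exact (Complex.ofRealCLM.contDiff.contDiffAt.comp x h2).mul (hF.contDiffAt hx)

lemma logProduct_smul (hF : IsSphereSmooth F) {r : ℝ} (hr : 0 < r)
    (y : Metric.sphere (0 : Space n) 1) :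
    logProduct ψ F (r • (y : Space n)) = ((ψ (Real.log r) : ℝ) : ℂ) * F y := by
  have hy : ‖(y : Space n)‖ = 1 := by simp
  rw [logProduct, if_neg (smul_ne_zero hr.ne' (ne_zero_of_sphere y)), hF.homogeneous r hr,
    norm_smul, hy, mul_one, Real.norm_eq_abs, abs_of_pos hr]

/-- The polar splitting of the gradient: the shell of the product is `ψ(log r) F`, and `r ∂_r` acts
on `ψ(log r)` as `ψ'`. -/
lemma norm_gradVec_logProduct (hψ : ContDiff ℝ ∞ ψ) (hs : HasCompactSupport ψ)
    (hF : IsSphereSmooth F) {r : ℝ} (hr : 0 < r) (y : Metric.sphere (0 : Space n) 1) :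
    ‖gradVec (logProduct ψ F) (r • (y : Space n))‖ ^ 2 = (r ^ 2)⁻¹ *
      (ψ (Real.log r) ^ 2 * ‖gradVec F y‖ ^ 2 + deriv ψ (Real.log r) ^ 2 * ‖F y‖ ^ 2) := by
  have hd := (contDiff_logProduct hψ hs hF).differentiable (by simp) (r • (y : Space n))
  have h := gradVec_shell (r := r) y hd
  have e1 : gradVec (shell (logProduct ψ F) r) y = ((ψ (Real.log r) : ℝ) : ℂ) • gradVec F y := by
    rw [← gradVec_const_mul _ (hF.differentiableAt (ne_zero_of_sphere y)), gradVec_eq_gradOf,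
      gradVec_eq_gradOf]
    congr 1
    refine Filter.EventuallyEq.fderiv_eq ?_
    filter_upwards [isOpen_compl_singleton.mem_nhds (ne_zero_of_sphere y)] with z hz
    have hz0 : 0 < ‖z‖ := norm_pos_iff.2 hz
    have hrz : 0 < r / ‖z‖ := by positivity
    rw [shell, logProduct, if_neg (smul_ne_zero hrz.ne' hz), hF.homogeneous _ hrz, norm_smul,
      Real.norm_eq_abs, abs_of_pos hrz, div_mul_cancel₀ _ hz0.ne']
  have e2 : fderiv ℝ (logProduct ψ F) (r • (y : Space n)) (r • (y : Space n)) =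
      ((deriv ψ (Real.log r) : ℝ) : ℂ) * F y := by
    have h1 : HasDerivAt (fun r : ℝ => r • (y : Space n)) (y : Space n) r := by
      simpa using (hasDerivAt_id r).smul_const (y : Space n)
    have h2 := hd.hasFDerivAt.comp_hasDerivAt r h1
    have h3 : HasDerivAt (fun r : ℝ => ((ψ (Real.log r) : ℝ) : ℂ) * F y)
        (((deriv ψ (Real.log r) * r⁻¹ : ℝ) : ℂ) * F y) r :=
      ((((hψ.differentiable (by simp) _).hasDerivAt).comp r
        (Real.hasDerivAt_log hr.ne')).ofReal_comp).mul_const _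
    have h4 := h2.unique (h3.congr_of_eventuallyEq (by
      filter_upwards [lt_mem_nhds hr] with s hs
      exact logProduct_smul hF hs y))
    rw [map_smul, h4, Complex.real_smul]
    push_cast
    have : (r : ℂ) ≠ 0 := by exact_mod_cast hr.ne'
    field_simp
  rw [e1, e2, norm_smul, norm_mul, Complex.norm_real, Complex.norm_real, mul_pow, mul_pow,
    Real.norm_eq_abs, Real.norm_eq_abs, sq_abs, sq_abs] at h
  rw [h]
  field_simp

lemma integral_Ioi_eq_integral_exp (g : ℝ → ℝ) :
    ∫ r in Set.Ioi (0 : ℝ), g r = ∫ t, Real.exp t * g (Real.exp t) := by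
  have h := integral_image_eq_integral_abs_deriv_smul MeasurableSet.univ
    (fun x _ => (Real.hasDerivAt_exp x).hasDerivWithinAt) Real.exp_injective.injOn g
  rw [Set.image_univ, Real.range_exp] at h
  simpa [abs_of_pos (Real.exp_pos _)] using h

/-- Under `r = e^t` the factors `dr = e^t dt`, `r^(n-1)` and `r⁻²` combine to `e^((n-2)t)`. -/
lemma exp_mul_pow (hn : 3 ≤ n) (t a : ℝ) :
    Real.exp t * (Real.exp t ^ (n - 1) * ((Real.exp t ^ 2)⁻¹ * a)) =
      Real.exp (((n : ℝ) - 2) * t) * a := by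
  obtain ⟨m, rfl⟩ := Nat.exists_eq_add_of_le hn
  have h : Real.exp (((3 + m : ℕ) - 2 : ℝ) * t) = Real.exp t ^ (m + 1) := by
    rw [← Real.exp_nat_mul]
    push_cast
    ring_nf
  have e : 3 + m - 1 = m + 2 := by omega
  have := (Real.exp_pos t).ne'
  rw [h, e]
  field_simp
  ring

lemma integral_gradVec_logProduct (hn : 3 ≤ n) (hψ : ContDiff ℝ ∞ ψ) (hs : HasCompactSupport ψ)
    (hF : IsSphereSmooth F) :
    ∫ x, ‖gradVec (logProduct ψ F) x‖ ^ 2 = ∫ t, Real.exp (((n : ℝ) - 2) * t) *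
      (ψ t ^ 2 * sphEnergy F + deriv ψ t ^ 2 * sphMass F) := by
  have : Nonempty (Fin n) := ⟨⟨0, by omega⟩⟩
  have hc := hF.continuous_gradVec
  rw [polar_integral_shell (integrable_norm_gradVec_sq (contDiff_logProduct hψ hs hF)
    (hasCompactSupport_logProduct hs))]
  have h : ∀ r ∈ Set.Ioi (0 : ℝ), r ^ (n - 1) *
      ∫ y, ‖gradVec (logProduct ψ F) (r • (y : Space n))‖ ^ 2 ∂(surf n) =
      r ^ (n - 1) * ((r ^ 2)⁻¹ * (ψ (Real.log r) ^ 2 * sphEnergy F +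
        deriv ψ (Real.log r) ^ 2 * sphMass F)) := by
    intro r hr
    congr 1
    have l1 : Integrable (fun y : Metric.sphere (0 : Space n) 1 => ‖gradVec F y‖ ^ 2) (surf n) :=
      integrable_surf (by fun_prop)
    unfold sphEnergy sphMass
    rw [← integral_const_mul, ← integral_const_mul, ← integral_add (l1.const_mul _)
      ((integrable_surf hF.continuous_norm_sq).const_mul _), ← integral_const_mul]
    exact integral_congr_ae (Eventually.of_forall fun y =>
      norm_gradVec_logProduct hψ hs hF hr y)
  rw [setIntegral_congr_fun measurableSet_Ioi h, integral_Ioi_eq_integral_exp]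
  simp only [Real.log_exp, exp_mul_pow hn]

lemma integral_dipoleDensity_logProduct (hn : 3 ≤ n) (hψ : ContDiff ℝ ∞ ψ)
    (hs : HasCompactSupport ψ) (hF : IsSphereSmooth F) {u : Space n} (hu : ‖u‖ = 1) :
    ∫ x, dipoleDensity u (logProduct ψ F) x = ∫ t, Real.exp (((n : ℝ) - 2) * t) *
      (ψ t ^ 2 * sphDipole u F) := by
  have : Nonempty (Fin n) := ⟨⟨0, by omega⟩⟩
  rw [polar_integral_shell (integrable_dipoleDensity hn hu
    (contDiff_logProduct hψ hs hF).continuous (hasCompactSupport_logProduct hs))]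
  have h : ∀ r ∈ Set.Ioi (0 : ℝ), r ^ (n - 1) *
      ∫ y, dipoleDensity u (logProduct ψ F) (r • (y : Space n)) ∂(surf n) =
      r ^ (n - 1) * ((r ^ 2)⁻¹ * (ψ (Real.log r) ^ 2 * sphDipole u F)) := by
    intro r hr
    have hr : (0 : ℝ) < r := hr
    congr 1
    unfold sphDipole
    rw [← integral_const_mul, ← integral_const_mul]
    refine integral_congr_ae (Eventually.of_forall fun y => ?_)
    have hy : ‖(y : Space n)‖ = 1 := by simp
    simp only [dipoleDensity, logProduct_smul hF hr, norm_smul, hy, Real.norm_eq_abs,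
      abs_of_pos hr, inner_smul_right, norm_mul, Complex.norm_real, mul_pow, sq_abs]
    field_simp
  rw [setIntegral_congr_fun measurableSet_Ioi h, integral_Ioi_eq_integral_exp]
  simp only [Real.log_exp, exp_mul_pow hn]

end LogProduct

lemma integral_mul_deriv_self_eq_zero {χ : ℝ → ℝ} (hχ : ContDiff ℝ ∞ χ)
    (hs : HasCompactSupport χ) : ∫ t, χ t * deriv χ t = 0 := by
  have hχ' : Continuous (deriv χ) := hχ.continuous_deriv (by simp)
  have hd : ∀ t, HasDerivAt (fun t => χ t * χ t) (2 * (χ t * deriv χ t)) t := fun t => by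
    have h := (hχ.differentiable (by simp) t).hasDerivAt
    exact (h.mul h).congr_deriv (by ring)
  have h := integral_eq_zero_of_hasDerivAt_of_integrable hd
    (((hχ.continuous.mul hχ').integrable_of_hasCompactSupport hs.mul_right).const_mul 2)
    ((hχ.continuous.mul hχ.continuous).integrable_of_hasCompactSupport hs.mul_right)
  rw [integral_const_mul] at h
  linarith

lemma integrable_sq_of_hasCompactSupport {χ : ℝ → ℝ} (hχ : Continuous χ)
    (hs : HasCompactSupport χ) : Integrable fun t => χ t ^ 2 := by
  have h : (fun t => χ t ^ 2) = fun t => χ t * χ t := by ext t; ring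
  rw [h]
  exact (hχ.mul hχ).integrable_of_hasCompactSupport hs.mul_right

/-- The dipole inequality, tested on functions in product form. -/
lemma DipoleInequality.one_dimensional (hn : 3 ≤ n) {γ : ℝ} (h : DipoleInequality n γ)
    {u : Space n} (hu : ‖u‖ = 1) {F : Space n → ℂ} (hF : IsSphereSmooth F) (hm : sphMass F = 1)
    {χ : ℝ → ℝ} (hχ : ContDiff ℝ ∞ χ) (hs : HasCompactSupport χ) :
    0 ≤ (sphEnergy F + γ * sphDipole u F + (((n : ℝ) - 2) / 2) ^ 2) * (∫ t, χ t ^ 2) +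
      ∫ t, deriv χ t ^ 2 := by
  set c : ℝ := ((n : ℝ) - 2) / 2 with hc
  have hχ' : Continuous (deriv χ) := hχ.continuous_deriv (by simp)
  -- The factor `e^(-ct)`, that is `r^(-(n-2)/2)`, cancels the weight `e^((n-2)t)`. It produces the
  -- Hardy term `c² χ²` and a cross term `-2c χ χ'` that integrates to zero.
  obtain ⟨ψ, hψdef⟩ : ∃ ψ : ℝ → ℝ, ψ = fun t => Real.exp (-c * t) * χ t := ⟨_, rfl⟩
  have hψ : ContDiff ℝ ∞ ψ := by rw [hψdef]; fun_prop
  have hψs : HasCompactSupport ψ := by rw [hψdef]; exact hs.mul_left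
  have hdψ : ∀ t, deriv ψ t = Real.exp (-c * t) * (deriv χ t - c * χ t) := by
    intro t
    rw [hψdef]
    have h1 := ((((hasDerivAt_id t).const_mul (-c)).exp).mul
      (hχ.differentiable (by simp) t).hasDerivAt).deriv
    refine h1.trans ?_
    simp only [id_eq]
    ring
  have hexp : ∀ t, Real.exp (((n : ℝ) - 2) * t) * Real.exp (-c * t) ^ 2 = 1 := by
    intro t
    rw [← Real.exp_nat_mul, ← Real.exp_add, hc]
    norm_num
    ring
  have h1 := (h u hu _ _ (memD1_testFunction (contDiff_logProduct hψ hψs hF)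
    (hasCompactSupport_logProduct hψs))).2.2
  rw [integral_gradVec_logProduct hn hψ hψs hF, integral_dipoleDensity_logProduct hn hψ hψs hF hu,
    hm] at h1
  have i1 := integrable_sq_of_hasCompactSupport hχ.continuous hs
  have i2 := integrable_sq_of_hasCompactSupport hχ' hs.deriv
  have i3 : Integrable fun t => χ t * deriv χ t :=
    (hχ.continuous.mul hχ').integrable_of_hasCompactSupport hs.mul_right
  have e1 : ∫ t, Real.exp (((n : ℝ) - 2) * t) * (ψ t ^ 2 * sphDipole u F) =
      sphDipole u F * ∫ t, χ t ^ 2 := by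
    rw [← integral_const_mul]
    refine integral_congr_ae (Eventually.of_forall fun t => ?_)
    simp only [hψdef]
    have h2 := hexp t
    generalize Real.exp (((n : ℝ) - 2) * t) = a at h2 ⊢
    generalize Real.exp (-c * t) = b at h2 ⊢
    linear_combination (χ t ^ 2 * sphDipole u F) * h2
  have e2 : ∫ t, Real.exp (((n : ℝ) - 2) * t) * (ψ t ^ 2 * sphEnergy F + deriv ψ t ^ 2 * 1) =
      ∫ t, ((sphEnergy F + c ^ 2) * χ t ^ 2 + deriv χ t ^ 2 + -(2 * c) * (χ t * deriv χ t)) := by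
    refine integral_congr_ae (Eventually.of_forall fun t => ?_)
    simp only [hdψ]
    simp only [hψdef]
    have h2 := hexp t
    generalize Real.exp (((n : ℝ) - 2) * t) = a at h2 ⊢
    generalize Real.exp (-c * t) = b at h2 ⊢
    linear_combination (χ t ^ 2 * sphEnergy F + (deriv χ t - c * χ t) ^ 2) * h2
  have i4 : Integrable fun t => (sphEnergy F + c ^ 2) * χ t ^ 2 + deriv χ t ^ 2 :=
    (i1.const_mul _).add i2
  rw [e1, e2, integral_add i4 (i3.const_mul _), integral_add (i1.const_mul _) i2,
    integral_const_mul, integral_const_mul, integral_mul_deriv_self_eq_zero hχ hs] at h1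
  linarith

/-- The one-dimensional inequality is tested on a widely spread bump `B(εt)`: its kinetic energy is
of order `ε²` relative to its mass, so `ε → 0` leaves the sign of the coefficient `q`. -/
lemma DipoleInequality.le_lowestEigenvalue (hn : 3 ≤ n) {γ : ℝ} (h : DipoleInequality n γ)
    {u : Space n} (hu : ‖u‖ = 1) : -(((n : ℝ) - 2) / 2) ^ 2 ≤ lowestEigenvalue u γ := by
  have : Nonempty (Fin n) := ⟨⟨0, by omega⟩⟩
  refine Dipole.le_lowestEigenvalue fun F hF hm => ?_
  let B : ContDiffBump (0 : ℝ) := ⟨1, 2, one_pos, one_lt_two⟩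
  set q := sphEnergy F + γ * sphDipole u F + (((n : ℝ) - 2) / 2) ^ 2 with hq
  have hI : 0 < ∫ t, B t ^ 2 := by
    refine (B.continuous.pow 2).integral_pos_of_hasCompactSupport_nonneg_nonzero
      (B.hasCompactSupport.comp_left (g := fun z : ℝ => z ^ 2) (by simp))
      (fun _ => sq_nonneg _) (x := 0) ?_
    have : B (0 : ℝ) = 1 := B.one_of_mem_closedBall (by simp [B])
    simp [this]
  have key : ∀ ε : ℝ, 0 < ε → 0 ≤ q * (∫ t, B t ^ 2) + ε ^ 2 * ∫ t, deriv B t ^ 2 := by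
    intro ε hε
    have h1 := h.one_dimensional hn hu hF hm (χ := fun t => B (ε * t))
      (B.contDiff.comp (contDiff_const.mul contDiff_id))
      (B.hasCompactSupport.comp_homeomorph (Homeomorph.mulLeft₀ ε hε.ne'))
    have hd : ∀ t, deriv (fun t => B (ε * t)) t = ε * deriv B (ε * t) := fun t => by
      rw [deriv_comp_mul_left, smul_eq_mul]
    rw [← hq] at h1
    simp only [hd, mul_pow] at h1
    rw [integral_const_mul, Measure.integral_comp_mul_left (fun t => B t ^ 2),
      Measure.integral_comp_mul_left (fun t => deriv B t ^ 2), abs_of_pos (inv_pos.2 hε),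
      smul_eq_mul, smul_eq_mul] at h1
    -- Multiplying by `ε` clears the Jacobian `ε⁻¹` of both rescaled integrals.
    have h2 := mul_nonneg hε.le h1
    refine h2.trans (le_of_eq ?_)
    field_simp
  have h0 : 0 ≤ q * (∫ t, B t ^ 2) := by
    have ht : Tendsto (fun ε : ℝ => q * (∫ t, B t ^ 2) + ε ^ 2 * ∫ t, deriv B t ^ 2) (𝓝[>] 0)
        (𝓝 (q * (∫ t, B t ^ 2) + 0 ^ 2 * ∫ t, deriv B t ^ 2)) :=
      ((by fun_prop : Continuous fun ε : ℝ => q * (∫ t, B t ^ 2) +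
        ε ^ 2 * ∫ t, deriv B t ^ 2).tendsto 0).mono_left nhdsWithin_le_nhds
    have := ge_of_tendsto ht (eventually_nhdsWithin_of_forall fun ε hε => key ε hε)
    simpa using this
  have := nonneg_of_mul_nonneg_left h0 hI
  linarith

end Optimality

end Dipole

end

/-! ### The critical coupling and strictness on `H¹`. -/

open Dipole in
/-- There is a unique critical dipole moment `γc`: it is the coupling constant at which the lowest
eigenvalue of `Λ` reaches `-(n-2)²/4`, and the largest constant in the dipole inequality. For all
`γ ∈ [0, γc]` the inequality is strict on `H¹(ℝⁿ)`. -/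
theorem theorem3p5 (n : ℕ) (hn : 3 ≤ n) :
    ∃ γc : ℝ, 0 < γc ∧
      (∀ u : Space n, ‖u‖ = 1 → ∀ γ : ℝ, 0 ≤ γ →
        (lowestEigenvalue u γ = -((n : ℝ) - 2) ^ 2 / 4 ↔ γ = γc) ∧
        (-((n : ℝ) - 2) ^ 2 / 4 ≤ lowestEigenvalue u γ ↔ γ ≤ γc)) ∧
      IsGreatest {γ : ℝ | 0 ≤ γ ∧ DipoleInequality n γ} γc ∧
      ∀ γ : ℝ, 0 ≤ γ → γ ≤ γc → ∀ u : Space n, ‖u‖ = 1 →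
        ∀ (f : Space n → ℂ) (G : Space n → EuclideanSpace ℂ (Fin n)), MemH1 f G →
          Integrable (dipoleDensity u f) ∧
          ∀ s : ℝ, s = 1 ∨ s = -1 →
            s * γ * ∫ x, dipoleDensity u f x ≤ ∫ x, ‖G x‖ ^ 2 ∧
            (s * γ * ∫ x, dipoleDensity u f x = ∫ x, ‖G x‖ ^ 2 ↔ f =ᵐ[volume] 0) := by
  have : Nonempty (Fin n) := ⟨⟨0, by omega⟩⟩
  have hn' : (3 : ℝ) ≤ n := by exact_mod_cast hn
  have hK : (0 : ℝ) < (((n : ℝ) - 2) / 2) ^ 2 := pow_pos (by linarith) 2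
  have e : -((n : ℝ) - 2) ^ 2 / 4 = -(((n : ℝ) - 2) / 2) ^ 2 := by ring
  obtain ⟨γc, hpos, hc⟩ := exists_critical (n := n) hK
  rw [e]
  -- The sign `s` is absorbed into the direction: the form with direction `-s u` is `∫ |G|² - s γ ∫
  -- dipoleDensity u f`, and the eigenvalue bound holds for every unit direction.
  have hform : ∀ γ : ℝ, 0 ≤ γ → γ ≤ γc → ∀ u : Space n, ‖u‖ = 1 → ∀ s : ℝ, s = 1 ∨ s = -1 →
      -(((n : ℝ) - 2) / 2) ^ 2 ≤ lowestEigenvalue (-s • u) γ ∧ ‖-s • u‖ = 1 := by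
    intro γ h0 hγ u hu s hs
    have hsu : ‖-s • u‖ = 1 := by
      rcases hs with rfl | rfl <;> simp [hu]
    exact ⟨((hc _ hsu γ h0).2).2 hγ, hsu⟩
  have hint : ∀ (s : ℝ) (u : Space n) (f : Space n → ℂ),
      ∫ x, dipoleDensity (-s • u) f x = -s * ∫ x, dipoleDensity u f x := by
    intro s u f
    rw [← integral_const_mul]
    refine integral_congr_ae (Eventually.of_forall fun x => ?_)
    simp only [dipoleDensity, real_inner_smul_left]
    ring
  refine ⟨γc, hpos, hc, ⟨⟨hpos.le, fun u hu f G hfG => ?_⟩, fun γ hγ => ?_⟩, ?_⟩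
  · obtain ⟨g, hg⟩ := hfG.exists_approximates hn
    refine ⟨(hg.dipole hn hu).1, ?_, ?_⟩
    · obtain ⟨h1, h2⟩ := hform γc hpos.le le_rfl u hu 1 (Or.inl rfl)
      have := hg.form_nonneg hn h2 h1
      rw [hint] at this
      linarith
    · obtain ⟨h1, h2⟩ := hform γc hpos.le le_rfl u hu (-1) (Or.inr rfl)
      have := hg.form_nonneg hn h2 h1
      rw [hint] at this
      linarith
  · obtain ⟨v, hv⟩ := exists_norm_eq (Space n) (zero_le_one' ℝ)
    exact (hc v hv γ hγ.1).2.1 (hγ.2.le_lowestEigenvalue hn hv)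
  · intro γ h0 hγ u hu f G hfG
    obtain ⟨g, hg, hL⟩ := hfG.exists_approximates
    refine ⟨(hg.dipole hn hu).1, fun s hs => ?_⟩
    obtain ⟨h1, h2⟩ := hform γ h0 hγ u hu s hs
    have hnn := hg.form_nonneg hn h2 h1
    have hzero := hg.eq_zero_of_form_eq_zero hn hfG.memLp hL h2 h1
    rw [hint] at hnn hzero
    refine ⟨by linarith, fun h => hzero (by linarith), fun h => ?_⟩
    have i1 : ∫ x, dipoleDensity u f x = 0 :=
      integral_eq_zero_of_ae (by filter_upwards [h] with x hx; simp [dipoleDensity, hx])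
    -- For `f = 0` equality also requires `G = 0`, which follows from the definition of the weak
    -- gradient.
    have i2 : ∫ x, ‖G x‖ ^ 2 = 0 :=
      integral_eq_zero_of_ae (by filter_upwards [hfG.grad_eq_zero h] with x hx; simp [hx])
    rw [i1, i2, mul_zero]
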